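/- **Conventions.** Let $S$ be a commutative ring. A *matrix factorization* over $S$ with potential $\varphi\in S$ is a $\mathbb Z$-graded $S$-module $M=\bigoplus_i M^i$ with an $S$-linear map $d=d_++d_-$, $d_\pm$ of degree $\pm1$, such that $d^2=\varphi$. Tensor products carry $d\otimes 1\pm 1\otimes d$ with the Koszul sign, and potentials add. A morphism is an $S$-linear map that commutes with $d$, is homogeneous for the $\mathbb Z/2$-grading and does not raise the $\mathbb Z$-degree. If $\varphi=0$, let $H^t(M)=\ker d/\operatorname{im} d$. A morphism $f:M\to M'$ of matrix factorizations of potential $\varphi$ is a *near-isomorphism* if for every matrix factorization $D$ on a projective $S$-module with potential $-\varphi$ the map $H^t(M\otimes_S D)\to H^t(M'\otimes_S D)$ is an isomorphism; a chain map of complexes of matrix factorizations is a near-isomorphism if it is one in each homological degree. If $M^i=0$ for $i>0$, let $\mathcal H(M)=H^0(M,d_+)$, placed in degree $0$ with $d=0$, and let $\pi:M\to\mathcal H(M)$ be the natural projection; $\mathcal H$ and $\pi$ are applied to complexes of matrix factorizations degree by degree. The Koszul factorization of sequences $(x_1,\dots,x_m),(y_1,\dots,y_m)$ is $\bigotimes_i\bigl(S\rightleftarrows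 S\bigr)$ with $d_+=x_i$ from degree $-1$ to degree $0$ and $d_-=y_i$ back. **The Khovanov–Rozansky complex.** Let $k$ be a commutative ring, $p\in k[x]$ with $p(0)=0$, and $T$ an oriented tangle diagram (planarity plays no role: only the signs of the crossings, the left/right order of the two outgoing and of the two incoming strands at each crossing, and the way the segments connect them are used). Its oriented graph $\mathcal G(T)$ has the crossings and the end points of strands as vertices and the segments between them as edges. Let $\tilde{\mathcal S}$ be the polynomial ring over $k$ with one variable $t_{x,e}$ for each flag $(x,e)$ (an edge $e$ with one of its two ends $x$), and $\mathcal S_T\subseteq\tilde{\mathcal S}$ the subring generated over $k$ by the variables of the flags at end points. At a crossing $x$ let $t_i,t_j$ be the variables of the left and right outgoing flags and $t_k,t_\ell$ those of the right and left incoming flags. Let $L'_x$ and $L''_x$ be Koszul factorizations on the sequences $(t_i+t_j-t_k-t_\ell,\;t_it_j-t_kt_\ell)$ and $(t_i-t_\ell,\;t_j-t_k)$, both of potential $p(t_i)+p(t_j)-p(t_k)-p(t_\ell)$. If $x$ is positive, $L_x$ is a two term complex $\rho^+:L'_x\to L''_x$ such that $\mathcal H(\rho^+)$ is the obvious projection;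 if $x$ is negative, $L_x$ is a two term complex $\rho^-:L''_x\to L'_x$ such that $\mathcal H(\rho^-)$ is multiplication by $t_i-t_k$; in both cases $L''_x$ is in homological degree $0$. For an edge $e$ from $x_a$ to $x_b$, with $t_a=t_{x_a,e}$ and $t_b=t_{x_b,e}$, let $L_e$ be the Koszul factorization of the pair $\bigl(t_b-t_a,\;\tfrac{p(t_b)-p(t_a)}{t_b-t_a}\bigr)$. Put $\mathcal R_p(T)=\bigotimes_eL_e\otimes\bigotimes_xL_x$, a complex of matrix factorizations over $\tilde{\mathcal S}$ with potential $\sum\epsilon(x,e)\,p(t_{x,e})\in\mathcal S_T$, the sum being over the flags at end points, where $\epsilon=1$ if $e$ is directed into $x$ and $\epsilon=-1$ otherwise. Let $\mathcal N(T)=\mathcal H(\mathcal R_p(T))$ and let $\pi_T:\mathcal R_p(T)\to\mathcal N(T)$ be the natural projection. **Theorem.** If $T$ is acyclic, that is, $\mathcal G(T)$ has no oriented cycles and $T$ has no crossingless closed components, then for every choice of the complexes $L_x$ as above $\pi_T:\mathcal R_p(T)\to\mathcal N(T)$ is a near-isomorphism, both as a map of complexes of matrix factorizations over $\tilde{\mathcal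 S}$ and as a map of complexes of matrix factorizations over $\mathcal S_T$. -/

import Mathlib

open TensorProduct

universe u u' v w x

noncomputable section

namespace KhR

/-! ### Internal gradings -/

section Grading

set_option linter.unusedSectionVars false

variable {S : Type u} [CommRing S] {G : Type} [DecidableEq G]
variable {M : Type v} [AddCommGroup M] [Module S M]
variable {N : Type w} [AddCommGroup N] [Module S N]

/-- The linear map on a graded module which is `F g` on the piece of degree `g`. -/
def piecewise {gr : G → Submodule S M} (h : DirectSum.IsInternal gr) (F : G → M →ₗ[S] N) :
    M →ₗ[S] N :=
  (DirectSum.toModule S G N fun g => F g ∘ₗ (gr g).subtype) ∘ₗ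
    (LinearEquiv.ofBijective (DirectSum.coeLinearMap gr) h).symm.toLinearMap

theorem piecewise_apply {gr : G → Submodule S M} (h : DirectSum.IsInternal gr)
    (F : G → M →ₗ[S] N) {g : G} {m : M} (hm : m ∈ gr g) : piecewise h F m = F g m := by
  have : (LinearEquiv.ofBijective (DirectSum.coeLinearMap gr) h).symm m
      = DirectSum.lof S G (fun g => gr g) g ⟨m, hm⟩ := by
    rw [LinearEquiv.symm_apply_eq]
    exact (DirectSum.coeLinearMap_lof gr g ⟨m, hm⟩).symm
  simp [piecewise, this]

/-- The projection of a graded module to its piece of degree `g`. -/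
def proj {gr : G → Submodule S M} (h : DirectSum.IsInternal gr) (g : G) : M →ₗ[S] M :=
  piecewise h fun g' => if g' = g then LinearMap.id else 0

theorem proj_same {gr : G → Submodule S M} (h : DirectSum.IsInternal gr) {g : G} {m : M}
    (hm : m ∈ gr g) : proj h g m = m := by
  simp [proj, piecewise_apply h _ hm]

theorem proj_ne {gr : G → Submodule S M} (h : DirectSum.IsInternal gr) {g g' : G} {m : M}
    (hm : m ∈ gr g') (hne : g' ≠ g) : proj h g m = 0 := by
  simp [proj, piecewise_apply h _ hm, hne]

/-- Induction over homogeneous elements. -/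
theorem graded_induction {gr : G → Submodule S M} (h : DirectSum.IsInternal gr)
    (P : Submodule S M) (hP : ∀ g, gr g ≤ P) (m : M) : m ∈ P := by
  have : (⨆ g, gr g) ≤ P := iSup_le hP
  rw [h.submodule_iSup_eq_top] at this
  exact this trivial

theorem graded_map_mem {gr : G → Submodule S M} (h : DirectSum.IsInternal gr) (f : M →ₗ[S] N)
    {P : Submodule S N} (hP : ∀ g, ∀ m ∈ gr g, f m ∈ P) (m : M) : f m ∈ P :=
  graded_induction h (P.comap f) hP m

theorem graded_ext {gr : G → Submodule S M} (h : DirectSum.IsInternal gr)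
    {f f' : M →ₗ[S] N} (hf : ∀ g, ∀ m ∈ gr g, f m = f' m) : f = f' := by
  ext m
  exact graded_induction h (LinearMap.eqLocus f f') (fun g m hm => hf g m hm) m

theorem proj_mem {gr : G → Submodule S M} (h : DirectSum.IsInternal gr) (g : G) (m : M) :
    proj h g m ∈ gr g := by
  refine graded_induction h ((gr g).comap (proj h g)) (fun g' m hm => ?_) m
  by_cases hg : g' = g
  · subst hg
    simpa [proj_same h hm] using hm
  · simp [proj_ne h hm hg]

/-- A criterion for a family of submodules to be a grading. -/
theorem isInternal_of_proj {gr : G → Submodule S M} (pr : G → M →ₗ[S] M)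
    (h1 : ∀ g, ∀ m ∈ gr g, pr g m = m) (h2 : ∀ g g', g' ≠ g → ∀ m ∈ gr g', pr g m = 0)
    (h3 : ∀ m, m ∈ ⨆ g, gr g) : DirectSum.IsInternal gr := by
  rw [DirectSum.isInternal_submodule_iff_iSupIndep_and_iSup_eq_top]
  refine ⟨fun g => ?_, eq_top_iff.2 fun m _ => h3 m⟩
  rw [Submodule.disjoint_def]
  intro m hm hm'
  have : (⨆ (j) (_ : j ≠ g), gr j) ≤ LinearMap.ker (pr g) :=
    iSup₂_le fun j hj m hm => h2 g j hj m hm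
  rw [← h1 g m hm]
  exact this hm'

theorem isInternal_top (g₀ : G) :
    DirectSum.IsInternal (fun g : G => if g = g₀ then (⊤ : Submodule S M) else ⊥) := by
  refine isInternal_of_proj (fun g => if g = g₀ then LinearMap.id else 0) ?_ ?_ ?_
  · intro g m hm
    by_cases hg : g = g₀ <;> simp_all
  · intro g g' hne m hm
    by_cases hg : g = g₀ <;> simp_all
  · intro m
    exact Submodule.mem_iSup_of_mem g₀ (by simp)

theorem isInternal_prod {gr : G → Submodule S M} {gr' : G → Submodule S N}
    (h : DirectSum.IsInternal gr) (h' : DirectSum.IsInternal gr') :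
    DirectSum.IsInternal (fun g => (gr g).prod (gr' g)) := by
  refine isInternal_of_proj (fun g => (proj h g).prodMap (proj h' g)) ?_ ?_ ?_
  · rintro g ⟨m, n⟩ ⟨hm, hn⟩
    simp [proj_same h hm, proj_same h' hn]
  · rintro g g' hne ⟨m, n⟩ ⟨hm, hn⟩
    simp [proj_ne h hm hne, proj_ne h' hn hne]
  · rintro ⟨m, n⟩
    have e : ((m, n) : M × N) = LinearMap.inl S M N m + LinearMap.inr S M N n := by simp
    rw [e]
    refine add_mem ?_ ?_
    · refine graded_map_mem h (LinearMap.inl S M N) (fun g m hm => ?_) m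
      exact Submodule.mem_iSup_of_mem g (by simpa using hm)
    · refine graded_map_mem h' (LinearMap.inr S M N) (fun g m hm => ?_) n
      exact Submodule.mem_iSup_of_mem g (by simpa using hm)

/-- A graded module becomes bigraded when it is put in a single second degree. -/
theorem isInternal_extend {gr : ℤ → Submodule S M} (h : DirectSum.IsInternal gr) (h₀ : ℤ) :
    DirectSum.IsInternal (fun g : ℤ × ℤ => if g.2 = h₀ then gr g.1 else ⊥) := by
  refine isInternal_of_proj (fun g => if g.2 = h₀ then proj h g.1 else 0) ?_ ?_ ?_
  · rintro ⟨i, a⟩ m hm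
    by_cases ha : a = h₀
    · simp only [ha, if_true] at hm ⊢
      exact proj_same h hm
    · simp_all
  · rintro ⟨i, a⟩ ⟨i', a'⟩ hne m hm
    by_cases ha : a = h₀
    · by_cases ha' : a' = h₀
      · simp only [ha, ha', if_true] at hm ⊢
        refine proj_ne h hm ?_
        rintro rfl
        exact hne (by simp [ha, ha'])
      · simp_all
    · simp_all
  · intro m
    refine graded_induction h _ (fun g m hm => ?_) m
    exact Submodule.mem_iSup_of_mem (g, h₀) (by simpa using hm)

/-- The grading of a tensor product: degree `g` is spanned by the `m ⊗ n` with
`deg m + deg n = g`. -/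
def tensorGr [AddCommGroup G] (gr : G → Submodule S M) (gr' : G → Submodule S N) (g : G) :
    Submodule S (M ⊗[S] N) :=
  ⨆ i : G, Submodule.map₂ (TensorProduct.mk S M N) (gr i) (gr' (g - i))

theorem tmul_mem_tensorGr [AddCommGroup G] {gr : G → Submodule S M} {gr' : G → Submodule S N}
    {i j g : G} (hg : i + j = g) {m : M} {n : N} (hm : m ∈ gr i) (hn : n ∈ gr' j) :
    m ⊗ₜ[S] n ∈ tensorGr gr gr' g := by
  subst hg
  refine Submodule.mem_iSup_of_mem i ?_
  exact Submodule.apply_mem_map₂ _ hm (by simpa using hn)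

theorem tensorGr_le [AddCommGroup G] {gr : G → Submodule S M} {gr' : G → Submodule S N}
    {g : G} {P : Submodule S (M ⊗[S] N)}
    (h : ∀ i j, i + j = g → ∀ m ∈ gr i, ∀ n ∈ gr' j, m ⊗ₜ[S] n ∈ P) :
    tensorGr gr gr' g ≤ P := by
  refine iSup_le fun i => Submodule.map₂_le.2 fun m hm n hn => ?_
  exact h i (g - i) (by abel) m hm n hn

/-- Two linear maps on a tensor product of graded modules agree if they agree on tensors of
homogeneous elements. -/
theorem tensor_graded_ext {P : Type*} [AddCommGroup P] [Module S P]
    {gr : G → Submodule S M} {gr' : G → Submodule S N}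
    (h : DirectSum.IsInternal gr) (h' : DirectSum.IsInternal gr')
    {f f' : M ⊗[S] N →ₗ[S] P}
    (hf : ∀ i j, ∀ m ∈ gr i, ∀ n ∈ gr' j, f (m ⊗ₜ n) = f' (m ⊗ₜ n)) : f = f' := by
  refine TensorProduct.ext (graded_ext h fun i m hm => ?_)
  exact graded_ext h' fun j n hn => hf i j m hm n hn

theorem isInternal_tensorGr [AddCommGroup G] {gr : G → Submodule S M} {gr' : G → Submodule S N}
    (h : DirectSum.IsInternal gr) (h' : DirectSum.IsInternal gr') :
    DirectSum.IsInternal (tensorGr gr gr') := by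
  let pr : G → M ⊗[S] N →ₗ[S] M ⊗[S] N := fun g =>
    TensorProduct.lift (piecewise h fun i =>
      (LinearMap.lcomp S (M ⊗[S] N) (proj h' (g - i))) ∘ₗ TensorProduct.mk S M N)
  have hpr : ∀ g i, ∀ m ∈ gr i, ∀ n, pr g (m ⊗ₜ n) = m ⊗ₜ proj h' (g - i) n := by
    intro g i m hm n
    simp [pr, piecewise_apply h _ hm]
  refine isInternal_of_proj pr ?_ ?_ ?_
  · intro g
    refine tensorGr_le (P := LinearMap.eqLocus (pr g) LinearMap.id) fun i j hij m hm n hn => ?_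
    have : proj h' (g - i) n = n := proj_same h' (by rwa [← hij, add_sub_cancel_left])
    simp [hpr g i m hm n, this]
  · intro g g' hne
    refine tensorGr_le (P := LinearMap.ker (pr g)) fun i j hij m hm n hn => ?_
    have : proj h' (g - i) n = 0 := proj_ne h' hn (by
      rintro rfl
      exact hne (by rw [← hij]; abel))
    simp [hpr g i m hm n, this]
  · intro x
    induction x with
    | zero => exact zero_mem _
    | add x y hx hy => exact add_mem hx hy
    | tmul m n =>
      refine graded_map_mem h ((TensorProduct.mk S M N).flip n)
        (fun i m hm => ?_) m
      refine graded_map_mem h' (TensorProduct.mk S M N m)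
        (fun j n hn => ?_) n
      exact Submodule.mem_iSup_of_mem (i + j) (tmul_mem_tensorGr rfl hm hn)

/-- The sign `(-1)^i` as an element of a ring. -/
def sgnElt (S : Type u) [CommRing S] (i : ℤ) : S := ((i.negOnePow : ℤ) : S)

theorem sgnElt_mul_self (i : ℤ) : sgnElt S i * sgnElt S i = 1 := by
  unfold sgnElt
  rw [← Int.cast_mul, ← Units.val_mul, Int.units_mul_self]
  simp

theorem sgnElt_succ (i : ℤ) : sgnElt S (i + 1) = - sgnElt S i := by
  simp [sgnElt, Int.negOnePow_succ]

theorem sgnElt_pred (i : ℤ) : sgnElt S (i - 1) = - sgnElt S i := by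
  simp [sgnElt, Int.negOnePow_sub]

theorem sgnElt_sub_even (i : ℤ) (n : ℕ) : sgnElt S (i - 2 * n) = sgnElt S i := by
  have : (2 * (n : ℤ)).negOnePow = 1 := Int.negOnePow_two_mul _
  simp [sgnElt, Int.negOnePow_sub, this]

/-- The operator `m ↦ (-1)^(deg m) m` of a graded module, for `deg : G → ℤ`. -/
def signOp {gr : G → Submodule S M} (h : DirectSum.IsInternal gr) (deg : G → ℤ) : M →ₗ[S] M :=
  piecewise h fun g => sgnElt S (deg g) • LinearMap.id

theorem signOp_apply {gr : G → Submodule S M} (h : DirectSum.IsInternal gr) (deg : G → ℤ)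
    {g : G} {m : M} (hm : m ∈ gr g) : signOp h deg m = sgnElt S (deg g) • m := by
  simp [signOp, piecewise_apply h _ hm]

theorem signOp_mem {gr : G → Submodule S M} (h : DirectSum.IsInternal gr) (deg : G → ℤ)
    {g : G} {m : M} (hm : m ∈ gr g) : signOp h deg m ∈ gr g := by
  rw [signOp_apply h deg hm]
  exact Submodule.smul_mem _ _ hm

theorem signOp_comp_self {gr : G → Submodule S M} (h : DirectSum.IsInternal gr) (deg : G → ℤ) :
    signOp h deg ∘ₗ signOp h deg = LinearMap.id := by
  refine graded_ext h fun g m hm => ?_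
  simp [signOp_apply h deg hm, smul_smul, sgnElt_mul_self]

theorem signOp_comm_signOp {gr : G → Submodule S M} (h : DirectSum.IsInternal gr)
    (deg deg' : G → ℤ) : signOp h deg ∘ₗ signOp h deg' = signOp h deg' ∘ₗ signOp h deg := by
  refine graded_ext h fun g m hm => ?_
  simp [signOp_apply h _ hm, smul_smul, mul_comm]

/-- The differential `d ⊗ 1 + s ⊗ d'` on a tensor product, where `s` is a sign operator. -/
def tensorD (s d : M →ₗ[S] M) (d' : N →ₗ[S] N) : M ⊗[S] N →ₗ[S] M ⊗[S] N :=
  TensorProduct.map d LinearMap.id + TensorProduct.map s d'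

@[simp] theorem tensorD_tmul (s d : M →ₗ[S] M) (d' : N →ₗ[S] N) (m : M) (n : N) :
    tensorD s d d' (m ⊗ₜ n) = d m ⊗ₜ n + s m ⊗ₜ d' n := by
  simp [tensorD]

theorem tensorD_add (s d₁ d₂ : M →ₗ[S] M) (d₁' d₂' : N →ₗ[S] N) :
    tensorD s d₁ d₁' + tensorD s d₂ d₂' = tensorD s (d₁ + d₂) (d₁' + d₂') := by
  refine TensorProduct.ext' fun m n => ?_
  simp only [LinearMap.add_apply, tensorD_tmul, TensorProduct.add_tmul, TensorProduct.tmul_add]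
  abel

theorem tensorD_sq {s d : M →ₗ[S] M} {d' : N →ₗ[S] N} {a b : S}
    (hs : s ∘ₗ s = LinearMap.id) (hsd : s ∘ₗ d = -(d ∘ₗ s))
    (hd : d ∘ₗ d = a • LinearMap.id) (hd' : d' ∘ₗ d' = b • LinearMap.id) :
    tensorD s d d' ∘ₗ tensorD s d d' = (a + b) • LinearMap.id := by
  refine TensorProduct.ext' fun m n => ?_
  have e1 : s (s m) = m := LinearMap.congr_fun hs m
  have e2 : s (d m) = -(d (s m)) := LinearMap.congr_fun hsd m
  have e3 : d (d m) = a • m := LinearMap.congr_fun hd m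
  have e4 : d' (d' n) = b • n := LinearMap.congr_fun hd' n
  simp only [LinearMap.comp_apply, tensorD_tmul, map_add, e1, e2, e3, e4, TensorProduct.neg_tmul,
    TensorProduct.tmul_smul, add_smul,
    TensorProduct.smul_tmul']
  abel

end Grading

/-! ### Matrix factorizations -/

/-- A `ℤ`-graded matrix factorization over `S`: a graded module `M = ⨁ i, gr i` with a map
`d = dp + dm`, where `dp` and `dm` have degree `1` and `-1`, such that `d² = pot`. -/
structure MatFac (S : Type u) [CommRing S] where
  carrier : Type v
  [grp : AddCommGroup carrier]
  [mod : Module S carrier]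
  gr : ℤ → Submodule S carrier
  internal : DirectSum.IsInternal gr
  dp : carrier →ₗ[S] carrier
  dm : carrier →ₗ[S] carrier
  dp_mem : ∀ i, ∀ m ∈ gr i, dp m ∈ gr (i + 1)
  dm_mem : ∀ i, ∀ m ∈ gr i, dm m ∈ gr (i - 1)
  pot : S
  d_sq : (dp + dm) ∘ₗ (dp + dm) = pot • LinearMap.id

attribute [instance] MatFac.grp MatFac.mod

namespace MatFac

section Basic

variable {S : Type u} [CommRing S]

/-- The total differential. -/
def d (M : MatFac.{u, v} S) : M.carrier →ₗ[S] M.carrier := M.dp + M.dm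

/-- The operator `(-1)^i` in degree `i`. -/
def sgn (M : MatFac.{u, v} S) : M.carrier →ₗ[S] M.carrier := signOp M.internal fun i => i

/-- The part of `M` in the degrees `i, i - 2, i - 4, …`. -/
def low (M : MatFac.{u, v} S) (i : ℤ) : Submodule S M.carrier := ⨆ n : ℕ, M.gr (i - 2 * n)

/-- Projection to degree `i`. -/
def pr (M : MatFac.{u, v} S) (i : ℤ) : M.carrier →ₗ[S] M.carrier := proj M.internal i

theorem gr_le_low (M : MatFac.{u, v} S) (i : ℤ) : M.gr i ≤ M.low i := fun m hm =>
  Submodule.mem_iSup_of_mem (0 : ℕ) (by simpa using hm)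

theorem low_le (M : MatFac.{u, v} S) (i : ℤ) : M.low (i - 2) ≤ M.low i := by
  refine iSup_le fun n m hm => Submodule.mem_iSup_of_mem (n + 1) ?_
  have : i - 2 * ((n + 1 : ℕ) : ℤ) = i - 2 - 2 * (n : ℤ) := by push_cast; ring
  rwa [this]

theorem pr_eq_zero_of_low (M : MatFac.{u, v} S) {i j : ℤ} (hij : i < j) {m : M.carrier}
    (hm : m ∈ M.low i) : M.pr j m = 0 := by
  have : M.low i ≤ LinearMap.ker (M.pr j) :=
    iSup_le fun n m hm => proj_ne M.internal hm (by omega)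
  exact this hm

theorem pr_dp (M : MatFac.{u, v} S) (i : ℤ) (m : M.carrier) :
    M.pr (i + 1) (M.dp m) = M.dp (M.pr i m) := by
  have : M.pr (i + 1) ∘ₗ M.dp = M.dp ∘ₗ M.pr i := by
    refine graded_ext M.internal fun j m hm => ?_
    by_cases hj : j = i
    · subst hj
      simp [pr, proj_same M.internal hm, proj_same M.internal (M.dp_mem _ _ hm)]
    · simp [pr, proj_ne M.internal hm hj,
        proj_ne M.internal (M.dp_mem _ _ hm) (by omega : j + 1 ≠ i + 1)]
  exact LinearMap.congr_fun this m

theorem dp_pr_neg_one (M : MatFac.{u, v} S) (m : M.carrier) :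
    M.dp (M.pr (-1) m) = M.pr 0 (M.dp m) := by
  have h := M.pr_dp (-1) m
  rw [neg_add_cancel] at h
  exact h.symm

theorem pr_dm (M : MatFac.{u, v} S) (i : ℤ) (m : M.carrier) :
    M.pr (i - 1) (M.dm m) = M.dm (M.pr i m) := by
  have : M.pr (i - 1) ∘ₗ M.dm = M.dm ∘ₗ M.pr i := by
    refine graded_ext M.internal fun j m hm => ?_
    by_cases hj : j = i
    · subst hj
      simp [pr, proj_same M.internal hm, proj_same M.internal (M.dm_mem _ _ hm)]
    · simp [pr, proj_ne M.internal hm hj,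
        proj_ne M.internal (M.dm_mem _ _ hm) (by omega : j - 1 ≠ i - 1)]
  exact LinearMap.congr_fun this m

theorem d_d (M : MatFac.{u, v} S) (m : M.carrier) : M.d (M.d m) = M.pot • m :=
  LinearMap.congr_fun M.d_sq m

theorem sgn_dp (M : MatFac.{u, v} S) : M.sgn ∘ₗ M.dp = -(M.dp ∘ₗ M.sgn) := by
  refine graded_ext M.internal fun i m hm => ?_
  simp [sgn, signOp_apply _ _ hm, signOp_apply _ _ (M.dp_mem _ _ hm), sgnElt_succ]

theorem sgn_dm (M : MatFac.{u, v} S) : M.sgn ∘ₗ M.dm = -(M.dm ∘ₗ M.sgn) := by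
  refine graded_ext M.internal fun i m hm => ?_
  simp [sgn, signOp_apply _ _ hm, signOp_apply _ _ (M.dm_mem _ _ hm), sgnElt_pred]

theorem sgn_d (M : MatFac.{u, v} S) : M.sgn ∘ₗ M.d = -(M.d ∘ₗ M.sgn) := by
  rw [d, LinearMap.comp_add, sgn_dp, sgn_dm, LinearMap.add_comp, neg_add]

theorem sgn_low (M : MatFac.{u, v} S) {i : ℤ} {m : M.carrier} (hm : m ∈ M.low i) :
    M.sgn m = sgnElt S i • m := by
  have : M.low i ≤ LinearMap.eqLocus M.sgn (sgnElt S i • LinearMap.id) := by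
    refine iSup_le fun n m hm => ?_
    have := signOp_apply M.internal (fun i => i) hm
    rw [sgnElt_sub_even] at this
    simpa [sgn] using this
  exact this hm

/-- A morphism of matrix factorizations: a linear map which commutes with the total
differential, is homogeneous for the `ℤ/2`-grading, and does not raise the `ℤ`-degree (so that
its leading part is a chain map for `dp`, on which `H⁰` can be evaluated). -/
structure Hom (M : MatFac.{u, v} S) (N : MatFac.{u, w} S) where
  toLin : M.carrier →ₗ[S] N.carrier
  map_low : ∀ i, ∀ m ∈ M.gr i, toLin m ∈ N.low i
  comm : toLin ∘ₗ M.d = N.d ∘ₗ toLin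

theorem Hom.comm_apply {M : MatFac.{u, v} S} {N : MatFac.{u, w} S} (f : Hom M N)
    (m : M.carrier) : f.toLin (M.d m) = N.d (f.toLin m) := LinearMap.congr_fun f.comm m

theorem Hom.map_low' {M : MatFac.{u, v} S} {N : MatFac.{u, w} S} (f : Hom M N) {i : ℤ}
    {m : M.carrier} (hm : m ∈ M.low i) : f.toLin m ∈ N.low i := by
  have : M.low i ≤ (N.low i).comap f.toLin := by
    refine iSup_le fun n m hm => ?_
    have h := f.map_low _ _ hm
    have hle : N.low (i - 2 * n) ≤ N.low i := by
      refine iSup_le fun k m hm => Submodule.mem_iSup_of_mem (n + k) ?_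
      have : i - 2 * ((n + k : ℕ) : ℤ) = i - 2 * n - 2 * k := by push_cast; ring
      rwa [this]
    exact hle h
  exact this hm

theorem Hom.sgn {M : MatFac.{u, v} S} {N : MatFac.{u, w} S} (f : Hom M N) :
    f.toLin ∘ₗ M.sgn = N.sgn ∘ₗ f.toLin := by
  refine graded_ext M.internal fun i m hm => ?_
  simp [sgn_low N (f.map_low i m hm), sgn_low M (M.gr_le_low i hm)]

/-- The leading part of a morphism commutes with `dp`. -/
theorem Hom.lead {M : MatFac.{u, v} S} {N : MatFac.{u, w} S} (f : Hom M N) {i : ℤ}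
    {m : M.carrier} (hm : m ∈ M.gr i) :
    N.dp (N.pr i (f.toLin m)) = N.pr (i + 1) (f.toLin (M.dp m)) := by
  have h := congrArg (N.pr (i + 1)) (f.comm_apply m)
  have h1 : N.pr (i + 1) (f.toLin (M.dm m)) = 0 :=
    N.pr_eq_zero_of_low (by omega) (f.map_low _ _ (M.dm_mem _ _ hm))
  have h2 : N.pr (i + 1) (N.dm (f.toLin m)) = 0 := by
    have := N.pr_dm (i + 2) (f.toLin m)
    rw [N.pr_eq_zero_of_low (by omega) (f.map_low _ _ hm), map_zero] at this
    rwa [show i + 2 - 1 = i + 1 by ring] at this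
  simp only [d, LinearMap.add_apply, map_add, h1, h2, add_zero, N.pr_dp] at h
  exact h.symm

/-! ### Tensor products -/

/-- The tensor product of matrix factorizations. -/
abbrev tensor (M : MatFac.{u, v} S) (N : MatFac.{u, w} S) : MatFac.{u, max v w} S where
  carrier := M.carrier ⊗[S] N.carrier
  gr := tensorGr M.gr N.gr
  internal := isInternal_tensorGr M.internal N.internal
  dp := tensorD M.sgn M.dp N.dp
  dm := tensorD M.sgn M.dm N.dm
  dp_mem := fun g => tensorGr_le (P := (tensorGr M.gr N.gr (g + 1)).comap _)
    fun i j hij m hm n hn => by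
      simp only [Submodule.mem_comap, tensorD_tmul]
      exact add_mem (tmul_mem_tensorGr (by omega) (M.dp_mem _ _ hm) hn)
        (tmul_mem_tensorGr (i := i) (j := j + 1) (by omega) (signOp_mem _ _ hm) (N.dp_mem _ _ hn))
  dm_mem := fun g => tensorGr_le (P := (tensorGr M.gr N.gr (g - 1)).comap _)
    fun i j hij m hm n hn => by
      simp only [Submodule.mem_comap, tensorD_tmul]
      exact add_mem (tmul_mem_tensorGr (by omega) (M.dm_mem _ _ hm) hn)
        (tmul_mem_tensorGr (i := i) (j := j - 1) (by omega) (signOp_mem _ _ hm) (N.dm_mem _ _ hn))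
  pot := M.pot + N.pot
  d_sq := by
    rw [tensorD_add]
    exact tensorD_sq (signOp_comp_self _ _) M.sgn_d M.d_sq N.d_sq

theorem tensor_d (M : MatFac.{u, v} S) (N : MatFac.{u, w} S) :
    (tensor M N).d = tensorD M.sgn M.d N.d :=
  tensorD_add _ _ _ _ _

/-- The morphism `f ⊗ 1 : M ⊗ D → M' ⊗ D`. -/
def Hom.rTensor {M : MatFac.{u, v} S} {M' : MatFac.{u, w} S} (f : Hom M M')
    (D : MatFac.{u, x} S) : Hom (tensor M D) (tensor M' D) where
  toLin := TensorProduct.map f.toLin LinearMap.id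
  map_low := fun g => tensorGr_le (P := ((tensor M' D).low g).comap _)
    fun i j hij m hm n hn => by
      have h : M'.low i ≤ ((tensor M' D).low g).comap ((TensorProduct.mk S _ _).flip n) :=
        iSup_le fun k m hm => Submodule.mem_iSup_of_mem k
          (tmul_mem_tensorGr (i := i - 2 * k) (by omega) hm hn)
      exact h (f.map_low i m hm)
  comm := by
    rw [tensor_d, tensor_d]
    refine TensorProduct.ext' fun m n => ?_
    have h1 := f.comm_apply m
    have h2 : f.toLin (M.sgn m) = M'.sgn (f.toLin m) := LinearMap.congr_fun f.sgn m
    simp [h1, h2]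

/-! ### Total homology and near-isomorphisms -/

/-- The total homology `ker d / im d` of a matrix factorization (of potential `0`). -/
abbrev Ht (M : MatFac.{u, v} S) : Type v :=
  LinearMap.ker M.d ⧸ (LinearMap.range M.d).submoduleOf (LinearMap.ker M.d)

/-- The map induced on total homology. -/
def Hom.mapHt {M : MatFac.{u, v} S} {N : MatFac.{u, w} S} (f : Hom M N) : Ht M →ₗ[S] Ht N :=
  Submodule.mapQ _ _
    (f.toLin.restrict (p := LinearMap.ker M.d) (q := LinearMap.ker N.d) fun m hm => by
      have := f.comm_apply m
      rw [LinearMap.mem_ker.1 hm, map_zero] at this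
      exact this.symm)
    (by
      rintro ⟨m, hm⟩ ⟨m', hm'⟩
      exact ⟨f.toLin m', by rw [← f.comm_apply, hm']; rfl⟩)

/-- A morphism `f : M → M'` is a near-isomorphism if for every matrix factorization `D` on a
projective module whose potential is the negative of that of `M`, the map
`Ht (M ⊗ D) → Ht (M' ⊗ D)` is an isomorphism. -/
def IsNearIso {M : MatFac.{u, v} S} {M' : MatFac.{u, w} S} (f : Hom M M') : Prop :=
  ∀ D : MatFac.{u, x} S, Module.Projective S D.carrier → D.pot = -M.pot →
    Function.Bijective (f.rTensor D).mapHt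

/-! ### The functor `H⁰` -/

/-- Cycles of `dp` in degree `0`. -/
def cycles (M : MatFac.{u, v} S) : Submodule S M.carrier := M.gr 0 ⊓ LinearMap.ker M.dp

/-- `H⁰(M, dp)`. -/
abbrev H0 (M : MatFac.{u, v} S) : Type v :=
  M.cycles ⧸ (LinearMap.range M.dp).submoduleOf M.cycles

theorem pot_smul_H0 (M : MatFac.{u, v} S) (x : H0 M) : M.pot • x = 0 := by
  obtain ⟨⟨m, hm⟩, rfl⟩ := Submodule.Quotient.mk_surjective _ x
  rw [← Submodule.Quotient.mk_smul, Submodule.Quotient.mk_eq_zero]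
  change M.pot • m ∈ LinearMap.range M.dp
  have h := congrArg (M.pr 0) (M.d_d m)
  have h0 : M.pr 0 m = m := proj_same M.internal hm.1
  have hp : M.dp m = 0 := hm.2
  have e : M.d m = M.dm m := by simp [d, hp]
  have h1 : M.pr 0 (M.dm (M.dm m)) = 0 :=
    proj_ne M.internal (M.dm_mem _ _ (M.dm_mem _ _ hm.1)) (by norm_num)
  have h2 : M.pr 0 (M.dp (M.dm m)) = M.dp (M.dm m) :=
    proj_same M.internal (by simpa using M.dp_mem _ _ (M.dm_mem _ _ hm.1))
  rw [e, map_smul, h0, d, LinearMap.add_apply, map_add, h1, h2, add_zero] at h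
  exact ⟨_, h⟩

/-- `H⁰(M, dp)` as a matrix factorization concentrated in degree `0`, with `d = 0`. -/
abbrev H (M : MatFac.{u, v} S) : MatFac.{u, v} S where
  carrier := H0 M
  gr := fun i => if i = 0 then ⊤ else ⊥
  internal := isInternal_top 0
  dp := 0
  dm := 0
  dp_mem := by simp
  dm_mem := by simp
  pot := M.pot
  d_sq := by
    refine LinearMap.ext fun x => ?_
    simpa using (pot_smul_H0 M x).symm

theorem H_d (M : MatFac.{u, v} S) : (H M).d = 0 := add_zero _

theorem H_low_zero (M : MatFac.{u, v} S) (x : H0 M) : x ∈ (H M).low 0 :=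
  (H M).gr_le_low 0 (by simp)

/-- `M` lives in nonpositive degrees. -/
def NonPos (M : MatFac.{u, v} S) : Prop := ∀ i, 0 < i → M.gr i = ⊥

theorem NonPos.gr_zero_le {M : MatFac.{u, v} S} (hM : NonPos M) : M.gr 0 ≤ M.cycles := by
  intro m hm
  have := M.dp_mem _ _ hm
  rw [hM (0 + 1) (by norm_num)] at this
  exact ⟨hm, by simpa using this⟩

/-- The underlying linear map of `π : M → H M`: the class of the degree `0` component. -/
def piLin (M : MatFac.{u, v} S) (hM : NonPos M) : M.carrier →ₗ[S] H0 M :=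
  Submodule.mkQ _ ∘ₗ LinearMap.codRestrict M.cycles (M.pr 0) fun m =>
    hM.gr_zero_le (proj_mem M.internal 0 m)

theorem piLin_eq_zero {M : MatFac.{u, v} S} (hM : NonPos M) {m : M.carrier}
    (hm : M.pr 0 m ∈ LinearMap.range M.dp) : piLin M hM m = 0 := by
  simp only [piLin, LinearMap.comp_apply, Submodule.mkQ_apply, Submodule.Quotient.mk_eq_zero]
  exact hm

theorem piLin_ne {M : MatFac.{u, v} S} (hM : NonPos M) {i : ℤ} (hi : i ≠ 0) {m : M.carrier}
    (hm : m ∈ M.gr i) : piLin M hM m = 0 := by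
  refine piLin_eq_zero hM ?_
  rw [pr, proj_ne M.internal hm hi]
  exact zero_mem _

/-- The natural projection `π : M → H M`. -/
def pi (M : MatFac.{u, v} S) (hM : NonPos M) : Hom M (H M) where
  toLin := piLin M hM
  map_low := by
    intro i m hm
    by_cases hi : i = 0
    · subst hi
      exact H_low_zero M _
    · rw [piLin_ne hM hi hm]
      exact zero_mem _
  comm := by
    rw [H_d, LinearMap.zero_comp]
    refine graded_ext M.internal fun i m hm => ?_
    simp only [LinearMap.comp_apply, LinearMap.zero_apply, d, LinearMap.add_apply, map_add]
    have h1 : piLin M hM (M.dp m) = 0 :=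
      piLin_eq_zero hM ⟨M.pr (-1) m, M.dp_pr_neg_one m⟩
    have h2 : piLin M hM (M.dm m) = 0 := by
      by_cases hi : i = 1
      · subst hi
        rw [hM 1 one_pos, Submodule.mem_bot] at hm
        simp [hm]
      · exact piLin_ne hM (by omega) (M.dm_mem _ _ hm)
    rw [h1, h2, add_zero]

/-- The leading part of a morphism on cycles. -/
def Hom.mapCycles {M : MatFac.{u, v} S} {N : MatFac.{u, w} S} (f : Hom M N) :
    M.cycles →ₗ[S] N.cycles :=
  (N.pr 0 ∘ₗ f.toLin).restrict fun m hm => by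
    refine ⟨proj_mem N.internal 0 _, ?_⟩
    have := f.lead hm.1
    rw [LinearMap.mem_ker.1 hm.2, map_zero, map_zero] at this
    exact this

theorem Hom.mapCycles_mem {M : MatFac.{u, v} S} {N : MatFac.{u, w} S} (f : Hom M N)
    (m : M.cycles) (hm : m ∈ (LinearMap.range M.dp).submoduleOf M.cycles) :
    f.mapCycles m ∈ (LinearMap.range N.dp).submoduleOf N.cycles := by
  obtain ⟨m', hm'⟩ : ∃ m', M.dp m' = m.1 := hm
  change N.pr 0 (f.toLin m.1) ∈ LinearMap.range N.dp
  have e : m.1 = M.dp (M.pr (-1) m') := by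
    rw [M.dp_pr_neg_one, hm']
    exact (proj_same M.internal m.2.1).symm
  have h := f.lead (proj_mem M.internal (-1) m')
  rw [neg_add_cancel] at h
  rw [e]
  exact ⟨_, h⟩

/-- The map induced on `H⁰`. -/
def Hom.mapH0 {M : MatFac.{u, v} S} {N : MatFac.{u, w} S} (f : Hom M N) : H0 M →ₗ[S] H0 N :=
  Submodule.mapQ _ _ f.mapCycles f.mapCycles_mem

/-- `H` on morphisms. -/
def Hom.mapH {M : MatFac.{u, v} S} {N : MatFac.{u, w} S} (f : Hom M N) : Hom (H M) (H N) where
  toLin := f.mapH0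
  map_low := by
    intro i m hm
    by_cases hi : i = 0
    · subst hi
      exact H_low_zero N _
    · have : m = 0 := by simpa [hi] using hm
      rw [this, map_zero]
      exact zero_mem _
  comm := by
    rw [H_d, H_d, LinearMap.zero_comp, LinearMap.comp_zero]

theorem piLin_surjective (M : MatFac.{u, v} S) (hM : NonPos M) :
    Function.Surjective (piLin M hM) := by
  intro x
  obtain ⟨⟨m, hm⟩, rfl⟩ := Submodule.Quotient.mk_surjective _ x
  refine ⟨m, ?_⟩
  have h : LinearMap.codRestrict M.cycles (M.pr 0)
      (fun m => hM.gr_zero_le (proj_mem M.internal 0 m)) m = ⟨m, hm⟩ :=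
    Subtype.ext (proj_same M.internal hm.1)
  rw [piLin, LinearMap.comp_apply, h]
  rfl

/-- The projection `π` is natural. -/
theorem pi_natural {M : MatFac.{u, v} S} {N : MatFac.{u, w} S} (hM : NonPos M) (hN : NonPos N)
    (f : Hom M N) : (pi N hN).toLin ∘ₗ f.toLin = f.mapH.toLin ∘ₗ (pi M hM).toLin := by
  refine graded_ext M.internal fun i m hm => ?_
  change piLin N hN (f.toLin m) = f.mapH0 (piLin M hM m)
  by_cases hi : i = 0
  · subst hi
    have h : LinearMap.codRestrict M.cycles (M.pr 0)
        (fun m => hM.gr_zero_le (proj_mem M.internal 0 m)) m = ⟨m, hM.gr_zero_le hm⟩ :=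
      Subtype.ext (proj_same M.internal hm)
    rw [piLin, piLin, LinearMap.comp_apply, LinearMap.comp_apply, h]
    rfl
  · rw [piLin_ne hM hi hm, map_zero]
    refine piLin_eq_zero hN ?_
    rcases lt_or_gt_of_ne hi with h | h
    · rw [N.pr_eq_zero_of_low h (f.map_low _ _ hm)]
      exact zero_mem _
    · rw [hM i h, Submodule.mem_bot] at hm
      rw [hm, map_zero, map_zero]
      exact zero_mem _

end Basic

/-! ### Restriction of scalars -/

section Restrict

variable {S : Type u} [CommRing S] {A : Type u'} [CommRing A]

/-- Restriction of scalars along `φ : A → S` of a matrix factorization whose potential is the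
image of `a`. -/
abbrev restrict (M : MatFac.{u, v} S) (φ : A →+* S) (a : A) (ha : φ a = M.pot) :
    MatFac.{u', v} A :=
  letI : Module A M.carrier := Module.compHom M.carrier φ
  { carrier := M.carrier
    mod := Module.compHom M.carrier φ
    gr := fun i =>
      { (M.gr i).toAddSubmonoid with
        smul_mem' := fun c m hm => (M.gr i).smul_mem (φ c) hm }
    internal := M.internal
    dp := { M.dp.toAddHom with map_smul' := fun c m => M.dp.map_smul (φ c) m }
    dm := { M.dm.toAddHom with map_smul' := fun c m => M.dm.map_smul (φ c) m }
    dp_mem := M.dp_mem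
    dm_mem := M.dm_mem
    pot := a
    d_sq := by
      ext m
      have := M.d_d m
      rw [← ha] at this
      exact this }

theorem restrict_low (M : MatFac.{u, v} S) (φ : A →+* S) (a : A) (ha : φ a = M.pot) (i : ℤ)
    (m : (M.restrict φ a ha).carrier) (hm : @Membership.mem M.carrier _ _ (M.low i) m) :
    m ∈ (M.restrict φ a ha).low i :=
  Submodule.iSup_induction (fun n : ℕ => M.gr (i - 2 * n))
    (motive := fun m : M.carrier => @Membership.mem (M.restrict φ a ha).carrier _ _
      ((M.restrict φ a ha).low i) m) hm
    (fun n _ hm => Submodule.mem_iSup_of_mem (p := fun n : ℕ => (M.restrict φ a ha).gr (i - 2 * n))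
      n hm)
    (zero_mem ((M.restrict φ a ha).low i))
    (fun _ _ hx hy => add_mem (S := Submodule A (M.restrict φ a ha).carrier) hx hy)

/-- Restriction of scalars of a morphism. -/
def Hom.restrict {M : MatFac.{u, v} S} {N : MatFac.{u, w} S} (f : Hom M N) (φ : A →+* S) (a : A)
    (ha : φ a = M.pot) (hb : φ a = N.pot) : Hom (M.restrict φ a ha) (N.restrict φ a hb) where
  toLin :=
    { toFun := f.toLin
      map_add' := f.toLin.map_add
      map_smul' := fun c m => f.toLin.map_smul (φ c) m }
  map_low := fun i m hm => restrict_low N φ a hb i _ (f.map_low i m hm)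
  comm := by
    ext m
    exact f.comm_apply m

end Restrict

end MatFac

/-! ### Complexes of matrix factorizations -/

/-- A cochain complex of matrix factorizations with a common potential. -/
structure MFCochain (S : Type u) [CommRing S] where
  X : ℤ → MatFac.{u, v} S
  pot : S
  pot_eq : ∀ h, pot = (X h).pot
  δ : ∀ h, MatFac.Hom (X h) (X (h + 1))
  δ_sq : ∀ h, (δ (h + 1)).toLin ∘ₗ (δ h).toLin = 0

namespace MFCochain

variable {S : Type u} [CommRing S]

/-- A chain map between complexes of matrix factorizations. -/
structure Hom (C : MFCochain.{u, v} S) (C' : MFCochain.{u, w} S) where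
  f : ∀ h, MatFac.Hom (C.X h) (C'.X h)
  comm : ∀ h, (f (h + 1)).toLin ∘ₗ (C.δ h).toLin = (C'.δ h).toLin ∘ₗ (f h).toLin

/-- A chain map is a near-isomorphism if it is one in every homological degree. -/
def IsNearIso {C : MFCochain.{u, v} S} {C' : MFCochain.{u, w} S} (φ : Hom C C') : Prop :=
  ∀ h, MatFac.IsNearIso.{u, v, w, x} (φ.f h)

/-- All the terms live in nonpositive degrees. -/
def NonPos (C : MFCochain.{u, v} S) : Prop := ∀ h, (C.X h).NonPos

/-- The functor `H` applied componentwise. -/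
abbrev H (C : MFCochain.{u, v} S) (hC : NonPos C) : MFCochain.{u, v} S where
  X := fun h => (C.X h).H
  pot := C.pot
  pot_eq := C.pot_eq
  δ := fun h => (C.δ h).mapH
  δ_sq := fun h => by
    refine LinearMap.ext fun x => ?_
    obtain ⟨m, rfl⟩ := MatFac.piLin_surjective (C.X h) (hC h) x
    have h1 := LinearMap.congr_fun (MatFac.pi_natural (hC h) (hC (h + 1)) (C.δ h)) m
    have h2 := LinearMap.congr_fun (MatFac.pi_natural (hC (h + 1)) (hC (h + 1 + 1)) (C.δ (h + 1)))
      ((C.δ h).toLin m)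
    have h3 : (C.δ (h + 1)).toLin ((C.δ h).toLin m) = 0 := LinearMap.congr_fun (C.δ_sq h) m
    simp only [LinearMap.comp_apply, h3, map_zero] at h1 h2
    change (C.δ (h + 1)).mapH.toLin ((C.δ h).mapH.toLin ((MatFac.pi (C.X h) (hC h)).toLin m)) = 0
    rw [← h1, ← h2]

/-- The natural projection `C → H C`. -/
def pi (C : MFCochain.{u, v} S) (hC : NonPos C) : Hom C (H C hC) where
  f := fun h => MatFac.pi (C.X h) (hC h)
  comm := fun h => MatFac.pi_natural (hC h) (hC (h + 1)) (C.δ h)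

/-- Restriction of scalars. -/
abbrev restrict {A : Type u'} [CommRing A] (C : MFCochain.{u, v} S) (φ : A →+* S) (a : A)
    (ha : φ a = C.pot) : MFCochain.{u', v} A where
  X := fun h => (C.X h).restrict φ a (ha.trans (C.pot_eq h))
  pot := a
  pot_eq := fun _ => rfl
  δ := fun h => (C.δ h).restrict φ a _ _
  δ_sq := fun h => LinearMap.ext fun m => LinearMap.congr_fun (C.δ_sq h) m

/-- Restriction of scalars of a chain map. -/
def Hom.restrict {A : Type u'} [CommRing A] {C : MFCochain.{u, v} S} {C' : MFCochain.{u, w} S}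
    (f : Hom C C') (φ : A →+* S) (a : A) (ha : φ a = C.pot) (hb : φ a = C'.pot) :
    Hom (C.restrict φ a ha) (C'.restrict φ a hb) where
  f := fun h => (f.f h).restrict φ a (ha.trans (C.pot_eq h)) (hb.trans (C'.pot_eq h))
  comm := fun h => LinearMap.ext fun m => LinearMap.congr_fun (f.comm h) m

end MFCochain

/-- A complex of matrix factorizations, organised as one bigraded module `⨁ gr (i, h)`, where
`i` is the degree as a matrix factorization and `h` is the homological degree; `dv` is the
differential of the complex. -/
structure MFComplex (S : Type u) [CommRing S] where
  carrier : Type v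
  [grp : AddCommGroup carrier]
  [mod : Module S carrier]
  gr : ℤ × ℤ → Submodule S carrier
  internal : DirectSum.IsInternal gr
  dp : carrier →ₗ[S] carrier
  dm : carrier →ₗ[S] carrier
  dv : carrier →ₗ[S] carrier
  dp_mem : ∀ i h, ∀ m ∈ gr (i, h), dp m ∈ gr (i + 1, h)
  dm_mem : ∀ i h, ∀ m ∈ gr (i, h), dm m ∈ gr (i - 1, h)
  dv_mem : ∀ i h, ∀ m ∈ gr (i, h), dv m ∈ ⨆ n : ℕ, gr (i - 2 * n, h + 1)
  pot : S
  d_sq : (dp + dm) ∘ₗ (dp + dm) = pot • LinearMap.id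
  dv_sq : dv ∘ₗ dv = 0
  dv_comm : dv ∘ₗ (dp + dm) = (dp + dm) ∘ₗ dv

attribute [instance] MFComplex.grp MFComplex.mod

namespace MFComplex

variable {S : Type u} [CommRing S]

/-- The sign `(-1)^i` in bidegree `(i, h)`. -/
def sgn (C : MFComplex.{u, v} S) : C.carrier →ₗ[S] C.carrier := signOp C.internal fun g => g.1

/-- The sign `(-1)^h` in bidegree `(i, h)`. -/
def vsgn (C : MFComplex.{u, v} S) : C.carrier →ₗ[S] C.carrier := signOp C.internal fun g => g.2

theorem sgn_dp (C : MFComplex.{u, v} S) : C.sgn ∘ₗ C.dp = -(C.dp ∘ₗ C.sgn) := by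
  refine graded_ext C.internal fun g m hm => ?_
  simp [sgn, signOp_apply _ _ hm, signOp_apply _ _ (C.dp_mem _ _ _ hm), sgnElt_succ]

theorem sgn_dm (C : MFComplex.{u, v} S) : C.sgn ∘ₗ C.dm = -(C.dm ∘ₗ C.sgn) := by
  refine graded_ext C.internal fun g m hm => ?_
  simp [sgn, signOp_apply _ _ hm, signOp_apply _ _ (C.dm_mem _ _ _ hm), sgnElt_pred]

theorem vsgn_dp (C : MFComplex.{u, v} S) : C.vsgn ∘ₗ C.dp = C.dp ∘ₗ C.vsgn := by
  refine graded_ext C.internal fun g m hm => ?_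
  simp [vsgn, signOp_apply _ _ hm, signOp_apply _ _ (C.dp_mem _ _ _ hm)]

theorem vsgn_dm (C : MFComplex.{u, v} S) : C.vsgn ∘ₗ C.dm = C.dm ∘ₗ C.vsgn := by
  refine graded_ext C.internal fun g m hm => ?_
  simp [vsgn, signOp_apply _ _ hm, signOp_apply _ _ (C.dm_mem _ _ _ hm)]

theorem sgn_dv (C : MFComplex.{u, v} S) : C.sgn ∘ₗ C.dv = C.dv ∘ₗ C.sgn := by
  refine graded_ext C.internal fun g m hm => ?_
  have h : (⨆ n : ℕ, C.gr (g.1 - 2 * n, g.2 + 1)) ≤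
      LinearMap.eqLocus C.sgn (sgnElt S g.1 • LinearMap.id) := by
    refine iSup_le fun n m hm => ?_
    have := signOp_apply C.internal (fun g => g.1) hm
    rw [sgnElt_sub_even] at this
    simpa [sgn] using this
  have h1 : C.sgn (C.dv m) = sgnElt S g.1 • C.dv m := h (C.dv_mem _ _ _ hm)
  have h2 : C.sgn m = sgnElt S g.1 • m := signOp_apply C.internal (fun g => g.1) hm
  simp [h1, h2]

theorem vsgn_dv (C : MFComplex.{u, v} S) : C.vsgn ∘ₗ C.dv = -(C.dv ∘ₗ C.vsgn) := by
  refine graded_ext C.internal fun g m hm => ?_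
  have h : (⨆ n : ℕ, C.gr (g.1 - 2 * n, g.2 + 1)) ≤
      LinearMap.eqLocus C.vsgn (-(sgnElt S g.2) • LinearMap.id) := by
    refine iSup_le fun n m hm => ?_
    have := signOp_apply C.internal (fun g => g.2) hm
    simp only [sgnElt_succ] at this
    simpa [vsgn] using this
  have h1 : C.vsgn (C.dv m) = -(sgnElt S g.2) • C.dv m := h (C.dv_mem _ _ _ hm)
  have h2 : C.vsgn m = sgnElt S g.2 • m := signOp_apply C.internal (fun g => g.2) hm
  simp [h1, h2]

/-- The part of homological degree `h`. -/
def part (C : MFComplex.{u, v} S) (h : ℤ) : Submodule S C.carrier := ⨆ i, C.gr (i, h)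

theorem dp_part (C : MFComplex.{u, v} S) (h : ℤ) : ∀ m ∈ C.part h, C.dp m ∈ C.part h := by
  have : C.part h ≤ (C.part h).comap C.dp :=
    iSup_le fun i m hm => Submodule.mem_iSup_of_mem (i + 1) (C.dp_mem i h m hm)
  exact this

theorem dm_part (C : MFComplex.{u, v} S) (h : ℤ) : ∀ m ∈ C.part h, C.dm m ∈ C.part h := by
  have : C.part h ≤ (C.part h).comap C.dm :=
    iSup_le fun i m hm => Submodule.mem_iSup_of_mem (i - 1) (C.dm_mem i h m hm)
  exact this

theorem dv_part (C : MFComplex.{u, v} S) (h : ℤ) : ∀ m ∈ C.part h, C.dv m ∈ C.part (h + 1) := by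
  have : C.part h ≤ (C.part (h + 1)).comap C.dv := by
    refine iSup_le fun i m hm => ?_
    have hle : (⨆ n : ℕ, C.gr (i - 2 * n, h + 1)) ≤ C.part (h + 1) :=
      iSup_le fun n => le_iSup (fun i => C.gr (i, h + 1)) (i - 2 * n)
    exact hle (C.dv_mem i h m hm)
  exact this

theorem iSup_submoduleOf {M : Type v} [AddCommGroup M] [Module S M] {ι : Type*}
    (p : ι → Submodule S M) (q : Submodule S M) (hp : ∀ i, p i ≤ q) (x : q)
    (hx : (x : M) ∈ ⨆ i, p i) : x ∈ ⨆ i, (p i).submoduleOf q := by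
  have h : Submodule.map q.subtype (⨆ i, (p i).submoduleOf q) = ⨆ i, p i := by
    rw [Submodule.map_iSup]
    refine iSup_congr fun i => ?_
    rw [Submodule.submoduleOf, Submodule.map_comap_subtype]
    exact inf_eq_right.2 (hp i)
  rw [← h] at hx
  obtain ⟨y, hy, hxy⟩ := hx
  rwa [← Subtype.ext hxy]

theorem isInternal_part (C : MFComplex.{u, v} S) (h : ℤ) :
    DirectSum.IsInternal fun i => (C.gr (i, h)).submoduleOf (C.part h) := by
  refine isInternal_of_proj (fun i => (proj C.internal (i, h)).restrict fun m _ =>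
    Submodule.mem_iSup_of_mem i (proj_mem C.internal (i, h) m)) ?_ ?_ ?_
  · intro i m hm
    exact Subtype.ext (proj_same C.internal hm)
  · rintro i i' hne m hm
    exact Subtype.ext (proj_ne C.internal hm fun e => hne (congrArg Prod.fst e))
  · intro m
    exact iSup_submoduleOf _ _ (fun i => le_iSup (fun i => C.gr (i, h)) i) m m.2

/-- The matrix factorization in homological degree `h`. -/
abbrev term (C : MFComplex.{u, v} S) (h : ℤ) : MatFac.{u, v} S where
  carrier := C.part h
  gr := fun i => (C.gr (i, h)).submoduleOf (C.part h)
  internal := C.isInternal_part h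
  dp := C.dp.restrict (C.dp_part h)
  dm := C.dm.restrict (C.dm_part h)
  dp_mem := fun i m hm => C.dp_mem i h m hm
  dm_mem := fun i m hm => C.dm_mem i h m hm
  pot := C.pot
  d_sq := LinearMap.ext fun m => Subtype.ext (LinearMap.congr_fun C.d_sq (m : C.carrier))

/-- The underlying complex. -/
def cochain (C : MFComplex.{u, v} S) : MFCochain.{u, v} S where
  X := C.term
  pot := C.pot
  pot_eq := fun _ => rfl
  δ := fun h =>
    { toLin := C.dv.restrict (C.dv_part h)
      map_low := fun i m hm =>
        iSup_submoduleOf (fun n : ℕ => C.gr (i - 2 * n, h + 1)) (C.part (h + 1))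
          (fun n => le_iSup (fun i => C.gr (i, h + 1)) (i - 2 * n)) _ (C.dv_mem i h m hm)
      comm := LinearMap.ext fun m => Subtype.ext (LinearMap.congr_fun C.dv_comm (m : C.carrier)) }
  δ_sq := fun _h => LinearMap.ext fun m =>
    Subtype.ext (LinearMap.congr_fun C.dv_sq (m : C.carrier))

/-- The bigraded module lives in nonpositive degrees `i`. -/
def NonPos (C : MFComplex.{u, v} S) : Prop := ∀ i h, 0 < i → C.gr (i, h) = ⊥

theorem NonPos.cochain {C : MFComplex.{u, v} S} (hC : C.NonPos) : C.cochain.NonPos := by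
  intro h i hi
  change (C.gr (i, h)).submoduleOf (C.part h) = ⊥
  rw [hC i h hi, Submodule.submoduleOf, Submodule.comap_bot]
  exact Submodule.ker_subtype _

/-- The tensor product of complexes of matrix factorizations. -/
abbrev tensor (C : MFComplex.{u, v} S) (C' : MFComplex.{u, w} S) : MFComplex.{u, max v w} S where
  carrier := C.carrier ⊗[S] C'.carrier
  gr := tensorGr C.gr C'.gr
  internal := isInternal_tensorGr C.internal C'.internal
  dp := tensorD C.sgn C.dp C'.dp
  dm := tensorD C.sgn C.dm C'.dm
  dv := tensorD C.vsgn C.dv C'.dv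
  dp_mem := fun a b => tensorGr_le (P := (tensorGr C.gr C'.gr (a + 1, b)).comap _) <| by
    rintro ⟨i, h⟩ ⟨j, k⟩ hij m hm n hn
    simp only [Prod.mk_add_mk, Prod.mk.injEq] at hij
    simp only [Submodule.mem_comap, tensorD_tmul]
    exact add_mem
      (tmul_mem_tensorGr (by simp only [Prod.mk_add_mk, Prod.mk.injEq]; omega)
        (C.dp_mem _ _ _ hm) hn)
      (tmul_mem_tensorGr (by simp only [Prod.mk_add_mk, Prod.mk.injEq]; omega)
        (signOp_mem _ _ hm) (C'.dp_mem _ _ _ hn))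
  dm_mem := fun a b => tensorGr_le (P := (tensorGr C.gr C'.gr (a - 1, b)).comap _) <| by
    rintro ⟨i, h⟩ ⟨j, k⟩ hij m hm n hn
    simp only [Prod.mk_add_mk, Prod.mk.injEq] at hij
    simp only [Submodule.mem_comap, tensorD_tmul]
    exact add_mem
      (tmul_mem_tensorGr (by simp only [Prod.mk_add_mk, Prod.mk.injEq]; omega)
        (C.dm_mem _ _ _ hm) hn)
      (tmul_mem_tensorGr (by simp only [Prod.mk_add_mk, Prod.mk.injEq]; omega)
        (signOp_mem _ _ hm) (C'.dm_mem _ _ _ hn))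
  dv_mem := fun a b => tensorGr_le
    (P := (⨆ n : ℕ, tensorGr C.gr C'.gr (a - 2 * n, b + 1)).comap _) <| by
    rintro ⟨i, h⟩ ⟨j, k⟩ hij m hm n hn
    simp only [Prod.mk_add_mk, Prod.mk.injEq] at hij
    simp only [Submodule.mem_comap, tensorD_tmul]
    have h1 : (⨆ r : ℕ, C.gr (i - 2 * r, h + 1)) ≤
        (⨆ r : ℕ, tensorGr C.gr C'.gr (a - 2 * r, b + 1)).comap
          ((TensorProduct.mk S _ _).flip n) :=
      iSup_le fun r m hm => Submodule.mem_iSup_of_mem r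
        (tmul_mem_tensorGr (by simp only [Prod.mk_add_mk, Prod.mk.injEq]; omega) hm hn)
    have h2 : (⨆ r : ℕ, C'.gr (j - 2 * r, k + 1)) ≤
        (⨆ r : ℕ, tensorGr C.gr C'.gr (a - 2 * r, b + 1)).comap
          (TensorProduct.mk S _ _ (C.vsgn m)) :=
      iSup_le fun r n hn => Submodule.mem_iSup_of_mem r
        (tmul_mem_tensorGr (by simp only [Prod.mk_add_mk, Prod.mk.injEq]; omega)
          (signOp_mem _ _ hm) hn)
    exact add_mem (h1 (C.dv_mem _ _ _ hm)) (h2 (C'.dv_mem _ _ _ hn))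
  pot := C.pot + C'.pot
  d_sq := by
    rw [tensorD_add]
    refine tensorD_sq (signOp_comp_self _ _) ?_ C.d_sq C'.d_sq
    rw [LinearMap.comp_add, LinearMap.add_comp, C.sgn_dp, C.sgn_dm, neg_add]
  dv_sq := by
    have h := tensorD_sq (a := (0 : S)) (b := (0 : S)) (signOp_comp_self C.internal fun g => g.2)
      C.vsgn_dv (by rw [C.dv_sq, zero_smul]) (d' := C'.dv) (by rw [C'.dv_sq, zero_smul])
    rw [add_zero, zero_smul] at h
    exact h
  dv_comm := by
    rw [tensorD_add]
    refine TensorProduct.ext' fun m n => ?_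
    have e1 := LinearMap.congr_fun C.dv_comm m
    have e2 := LinearMap.congr_fun C'.dv_comm n
    have e3 := LinearMap.congr_fun C.sgn_dv m
    have e4 := LinearMap.congr_fun C.vsgn_dp m
    have e5 := LinearMap.congr_fun C.vsgn_dm m
    have e6 : C.vsgn (C.sgn m) = C.sgn (C.vsgn m) :=
      LinearMap.congr_fun (signOp_comm_signOp C.internal (fun g => g.2) (fun g => g.1)) m
    simp only [LinearMap.comp_apply, LinearMap.add_apply, map_add] at e1 e2 e3 e4 e5
    simp only [LinearMap.comp_apply, tensorD_tmul, map_add, LinearMap.add_apply, e3, e4, e5, e6]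
    rw [e1, e2]
    abel

theorem NonPos.tensor {C : MFComplex.{u, v} S} {C' : MFComplex.{u, w} S} (hC : C.NonPos)
    (hC' : C'.NonPos) : (tensor C C').NonPos := by
  intro a b hab
  refine le_bot_iff.1 (tensorGr_le ?_)
  rintro ⟨i, h⟩ ⟨j, k⟩ hij m hm n hn
  simp only [Prod.mk_add_mk, Prod.mk.injEq] at hij
  by_cases hi : 0 < i
  · rw [hC i h hi, Submodule.mem_bot] at hm
    simp [hm]
  · rw [hC' j k (by omega), Submodule.mem_bot] at hn
    simp [hn]

/-- The ground ring in bidegree `(0, 0)`: the empty tensor product. -/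
abbrev unit (S : Type u) [CommRing S] : MFComplex.{u, u} S where
  carrier := S
  gr := fun g => if g = (0, 0) then ⊤ else ⊥
  internal := isInternal_top (0, 0)
  dp := 0
  dm := 0
  dv := 0
  dp_mem := by simp
  dm_mem := by simp
  dv_mem := by simp
  pot := 0
  d_sq := by simp
  dv_sq := by simp
  dv_comm := by simp

theorem unit_nonPos : (unit S).NonPos := by
  intro i h hi
  simp [hi.ne']

/-- The tensor product of a list of complexes. -/
def tensorList : List (MFComplex.{u, u} S) → MFComplex.{u, u} S
  | [] => unit S
  | C :: l => tensor C (tensorList l)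

theorem NonPos.tensorList : ∀ {l : List (MFComplex.{u, u} S)}, (∀ C ∈ l, C.NonPos) →
    (MFComplex.tensorList l).NonPos
  | [], _ => unit_nonPos
  | C :: l, h => NonPos.tensor (h C (by simp)) (NonPos.tensorList fun C' hC' => h C' (by simp [hC']))

theorem tensorList_pot : ∀ l : List (MFComplex.{u, u} S),
    (tensorList l).pot = (l.map MFComplex.pot).sum
  | [] => rfl
  | C :: l => by
    rw [List.map_cons, List.sum_cons, ← tensorList_pot l]
    rfl

/-- A matrix factorization as a complex in homological degree `0`. -/
abbrev single (M : MatFac.{u, v} S) : MFComplex.{u, v} S where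
  carrier := M.carrier
  gr := fun g => if g.2 = 0 then M.gr g.1 else ⊥
  internal := isInternal_extend M.internal 0
  dp := M.dp
  dm := M.dm
  dv := 0
  dp_mem := by
    intro i h m hm
    by_cases hh : h = 0
    · simp only [hh, if_true] at hm ⊢
      exact M.dp_mem i m hm
    · simp_all
  dm_mem := by
    intro i h m hm
    by_cases hh : h = 0
    · simp only [hh, if_true] at hm ⊢
      exact M.dm_mem i m hm
    · simp_all
  dv_mem := by simp
  pot := M.pot
  d_sq := M.d_sq
  dv_sq := by simp
  dv_comm := by simp

theorem single_nonPos {M : MatFac.{u, v} S} (hM : M.NonPos) : (single M).NonPos := by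
  intro i h hi
  simp [hM i hi]

/-- The two term complex `f : M → N`, with `M` in homological degree `h₀` and `N` in homological
degree `h₀ + 1`. -/
abbrev twoTerm (h₀ : ℤ) {M : MatFac.{u, v} S} {N : MatFac.{u, w} S} (f : MatFac.Hom M N)
    (hpot : N.pot = M.pot) : MFComplex.{u, max v w} S where
  carrier := M.carrier × N.carrier
  gr := fun g => (if g.2 = h₀ then M.gr g.1 else ⊥).prod (if g.2 = h₀ + 1 then N.gr g.1 else ⊥)
  internal := isInternal_prod (isInternal_extend M.internal h₀) (isInternal_extend N.internal (h₀ + 1))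
  dp := M.dp.prodMap N.dp
  dm := M.dm.prodMap N.dm
  dv := LinearMap.inr S _ _ ∘ₗ f.toLin ∘ₗ LinearMap.fst S _ _
  dp_mem := by
    rintro i h ⟨m, n⟩ ⟨hm, hn⟩
    refine ⟨?_, ?_⟩
    · by_cases hh : h = h₀
      · simp only [hh, if_true] at hm ⊢
        exact M.dp_mem i m hm
      · simp_all
    · by_cases hh : h = h₀ + 1
      · simp only [hh, if_true] at hn ⊢
        exact N.dp_mem i n hn
      · simp_all
  dm_mem := by
    rintro i h ⟨m, n⟩ ⟨hm, hn⟩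
    refine ⟨?_, ?_⟩
    · by_cases hh : h = h₀
      · simp only [hh, if_true] at hm ⊢
        exact M.dm_mem i m hm
      · simp_all
    · by_cases hh : h = h₀ + 1
      · simp only [hh, if_true] at hn ⊢
        exact N.dm_mem i n hn
      · simp_all
  dv_mem := by
    rintro i h ⟨m, n⟩ ⟨hm, hn⟩
    by_cases hh : h = h₀
    · subst hh
      simp only [if_true] at hm
      have hle : N.low i ≤ (⨆ n : ℕ, Submodule.prod (if h + 1 = h then M.gr (i - 2 * n) else ⊥)
          (if h + 1 = h + 1 then N.gr (i - 2 * n) else ⊥)).comap (LinearMap.inr S _ _) :=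
        iSup_le fun r n hn => Submodule.mem_iSup_of_mem r (by simpa using hn)
      exact hle (f.map_low i m hm)
    · have : m = 0 := by simpa [hh] using hm
      subst this
      simp only [LinearMap.comp_apply, LinearMap.fst_apply, map_zero]
      exact zero_mem _
  pot := M.pot
  d_sq := by
    refine LinearMap.ext fun x => ?_
    have h1 := M.d_d x.1
    have h2 := N.d_d x.2
    rw [hpot] at h2
    exact Prod.ext h1 h2
  dv_sq := by
    refine LinearMap.ext fun x => ?_
    simp
  dv_comm := by
    refine LinearMap.ext fun x => ?_
    have h := f.comm_apply x.1
    refine Prod.ext ?_ h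
    simp

theorem twoTerm_nonPos {h₀ : ℤ} {M : MatFac.{u, v} S} {N : MatFac.{u, w} S} {f : MatFac.Hom M N}
    {hpot : N.pot = M.pot} (hM : M.NonPos) (hN : N.NonPos) : (twoTerm h₀ f hpot).NonPos := by
  intro i h hi
  simp [hM i hi, hN i hi]

end MFComplex

/-! ### Koszul matrix factorizations -/

section Koszul

variable {S : Type u} [CommRing S]

/-- The Koszul matrix factorization `S ⇄ S` of the pair `(x, y)`. An element `(a, b)` has the
component `a` in degree `-1` and `b` in degree `0`; `dp` is multiplication by `x` and `dm` is
multiplication by `y`. -/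
abbrev koszul (x y : S) : MatFac.{u, u} S where
  carrier := S × S
  gr := fun i => (if i = -1 then ⊤ else ⊥ : Submodule S S).prod (if i = 0 then ⊤ else ⊥)
  internal := isInternal_prod (isInternal_top (-1)) (isInternal_top 0)
  dp := LinearMap.inr S S S ∘ₗ (x • LinearMap.id) ∘ₗ LinearMap.fst S S S
  dm := LinearMap.inl S S S ∘ₗ (y • LinearMap.id) ∘ₗ LinearMap.snd S S S
  dp_mem := by
    rintro i ⟨a, b⟩ ⟨ha, hb⟩
    by_cases hi : i = -1
    · subst hi
      simp
    · have : a = 0 := by simpa [hi] using ha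
      subst this
      simp
  dm_mem := by
    rintro i ⟨a, b⟩ ⟨ha, hb⟩
    by_cases hi : i = 0
    · subst hi
      simp
    · have : b = 0 := by simpa [hi] using hb
      subst this
      simp
  pot := x * y
  d_sq := by
    refine LinearMap.ext fun m => ?_
    refine Prod.ext ?_ ?_ <;> simp <;> ring

theorem koszul_nonPos (x y : S) : (koszul x y).NonPos := by
  intro i hi
  have h1 : i ≠ -1 := by omega
  simp [h1, hi.ne']

theorem MatFac.NonPos.tensor {M : MatFac.{u, v} S} {N : MatFac.{u, w} S} (hM : M.NonPos)
    (hN : N.NonPos) : (M.tensor N).NonPos := by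
  intro a ha
  refine le_bot_iff.1 (tensorGr_le ?_)
  intro i j hij m hm n hn
  by_cases hi : 0 < i
  · rw [hM i hi, Submodule.mem_bot] at hm
    simp [hm]
  · rw [hN j (by omega), Submodule.mem_bot] at hn
    simp [hn]

/-- The Koszul matrix factorization of the pair of sequences `((x₁, x₂), (y₁, y₂))`. -/
abbrev koszul₂ (x₁ x₂ y₁ y₂ : S) : MatFac.{u, u} S :=
  (koszul x₁ y₁).tensor (koszul x₂ y₂)

theorem koszul₂_nonPos (x₁ x₂ y₁ y₂ : S) : (koszul₂ x₁ x₂ y₁ y₂).NonPos :=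
  (koszul_nonPos x₁ y₁).tensor (koszul_nonPos x₂ y₂)

/-- The class of `1` in `H (koszul₂ x₁ x₂ y₁ y₂) = S / (x₁, x₂)`; it generates this module. -/
def koszulOne (x₁ x₂ y₁ y₂ : S) : (koszul₂ x₁ x₂ y₁ y₂).H0 :=
  MatFac.piLin _ (koszul₂_nonPos x₁ x₂ y₁ y₂) (((0, 1) : S × S) ⊗ₜ[S] ((0, 1) : S × S))

/-! ### The complex of a crossing -/

/-- The Koszul matrix factorization on the sequence `(ti + tj - tk - tl, ti tj - tk tl)`. -/
abbrev singularMF (ti tj tk tl y₁ y₂ : S) : MatFac.{u, u} S :=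
  koszul₂ (ti + tj - tk - tl) (ti * tj - tk * tl) y₁ y₂

/-- The Koszul matrix factorization on the sequence `(ti - tl, tj - tk)`. -/
abbrev smoothMF (ti tj tk tl z₁ z₂ : S) : MatFac.{u, u} S :=
  koszul₂ (ti - tl) (tj - tk) z₁ z₂

/-- A choice of the two Koszul matrix factorizations `L'` (singular) and `L''` (smooth) of a
crossing, both of potential `φ`. -/
structure CrossingMF (ti tj tk tl φ : S) where
  y₁ : S
  y₂ : S
  z₁ : S
  z₂ : S
  pot' : (ti + tj - tk - tl) * y₁ + (ti * tj - tk * tl) * y₂ = φ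
  pot'' : (ti - tl) * z₁ + (tj - tk) * z₂ = φ

namespace CrossingMF

variable {ti tj tk tl φ : S} (c : CrossingMF ti tj tk tl φ)

/-- `L'` -/
abbrev L' : MatFac.{u, u} S := singularMF ti tj tk tl c.y₁ c.y₂

/-- `L''` -/
abbrev L'' : MatFac.{u, u} S := smoothMF ti tj tk tl c.z₁ c.z₂

/-- The class of `1` in `H L' = S / (ti + tj - tk - tl, ti tj - tk tl)`. -/
abbrev one' : c.L'.H0 := koszulOne _ _ _ _

/-- The class of `1` in `H L'' = S / (ti - tl, tj - tk)`. -/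
abbrev one'' : c.L''.H0 := koszulOne _ _ _ _

theorem pot_eq : c.L'.pot = c.L''.pot := c.pot'.trans c.pot''.symm

end CrossingMF

/-- A complex `ρ⁺ : L' → L''` of a positive crossing: `ρ⁺` induces on `H` the obvious projection
`S / (ti + tj - tk - tl, ti tj - tk tl) → S / (ti - tl, tj - tk)`. -/
structure PositiveCrossing (ti tj tk tl φ : S) extends CrossingMF ti tj tk tl φ where
  ρ : MatFac.Hom toCrossingMF.L' toCrossingMF.L''
  hρ : ρ.mapH0 toCrossingMF.one' = toCrossingMF.one''

/-- A complex `ρ⁻ : L'' → L'` of a negative crossing: `ρ⁻` induces on `H` the map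
`S / (ti - tl, tj - tk) → S / (ti + tj - tk - tl, ti tj - tk tl)` given by multiplication by
`ti - tk`. -/
structure NegativeCrossing (ti tj tk tl φ : S) extends CrossingMF ti tj tk tl φ where
  ρ : MatFac.Hom toCrossingMF.L'' toCrossingMF.L'
  hρ : ρ.mapH0 toCrossingMF.one'' = (ti - tk) • toCrossingMF.one'

/-- The data of the complex of a crossing of given sign (`true` for positive). -/
def CrossingData (positive : Bool) (ti tj tk tl φ : S) : Type u :=
  match positive with
  | true => PositiveCrossing ti tj tk tl φ
  | false => NegativeCrossing ti tj tk tl φ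

/-- The two term complex of a crossing, with `L''` in homological degree `0`. -/
def CrossingData.complex {ti tj tk tl φ : S} : {positive : Bool} →
    CrossingData positive ti tj tk tl φ → MFComplex.{u, u} S
  | true, (c : PositiveCrossing ti tj tk tl φ) =>
    MFComplex.twoTerm (-1) c.ρ c.toCrossingMF.pot_eq.symm
  | false, (c : NegativeCrossing ti tj tk tl φ) =>
    MFComplex.twoTerm 0 c.ρ c.toCrossingMF.pot_eq

theorem CrossingData.complex_nonPos {ti tj tk tl φ : S} : ∀ {positive : Bool}
    (c : CrossingData positive ti tj tk tl φ), c.complex.NonPos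
  | true, (c : PositiveCrossing ti tj tk tl φ) =>
    MFComplex.twoTerm_nonPos (hpot := c.toCrossingMF.pot_eq.symm)
      (koszul₂_nonPos _ _ _ _) (koszul₂_nonPos _ _ _ _)
  | false, (c : NegativeCrossing ti tj tk tl φ) =>
    MFComplex.twoTerm_nonPos (hpot := c.toCrossingMF.pot_eq)
      (koszul₂_nonPos _ _ _ _) (koszul₂_nonPos _ _ _ _)

theorem CrossingData.complex_pot {ti tj tk tl φ : S} : ∀ {positive : Bool}
    (c : CrossingData positive ti tj tk tl φ), c.complex.pot = φ
  | true, c => (show PositiveCrossing ti tj tk tl φ from c).pot'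
  | false, c => (show NegativeCrossing ti tj tk tl φ from c).pot''

/-! ### Existence of the complex of a crossing -/

theorem exists_koszulHom {x₁ x₂ y₁ y₂ x₁' x₂' y₁' y₂' : S} (g₀ g₂ a b c d : S)
    (h1 : g₀ * x₁ = a * x₁' + b * x₂') (h2 : g₀ * x₂ = c * x₁' + d * x₂')
    (h3 : y₁ * a + y₂ * c = g₀ * y₁') (h4 : y₁ * b + y₂ * d = g₀ * y₂')
    (h5 : x₂ * a - x₁ * c = g₂ * x₂') (h6 : x₁ * d - x₂ * b = g₂ * x₁')
    (h7 : a * y₂' - b * y₁' = y₂ * g₂) (h8 : d * y₁' - c * y₂' = y₁ * g₂) :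
    ∃ f : MatFac.Hom (koszul₂ x₁ x₂ y₁ y₂) (koszul₂ x₁' x₂' y₁' y₂'),
      f.mapH0 (koszulOne x₁ x₂ y₁ y₂) = g₀ • koszulOne x₁' x₂' y₁' y₂' := by
  obtain ⟨e, hee'⟩ : ∃ e : S × S, e = (1, 0) := ⟨_, rfl⟩
  obtain ⟨o, hoo'⟩ : ∃ o : S × S, o = (0, 1) := ⟨_, rfl⟩
  let β : S × S →ₗ[S] S × S →ₗ[S] (S × S) ⊗[S] (S × S) := LinearMap.mk₂ S
    (fun m n => (m.1 * n.1 * g₂) • (e ⊗ₜ e) + (m.1 * n.2) • (a • (e ⊗ₜ o) + b • (o ⊗ₜ e))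
      + (m.2 * n.1) • (c • (e ⊗ₜ o) + d • (o ⊗ₜ e)) + (m.2 * n.2 * g₀) • (o ⊗ₜ o))
    (fun m m' n => by simp only [Prod.fst_add, Prod.snd_add]; module)
    (fun r m n => by simp only [Prod.smul_fst, Prod.smul_snd, smul_eq_mul]; module)
    (fun m n n' => by simp only [Prod.fst_add, Prod.snd_add]; module)
    (fun r m n => by simp only [Prod.smul_fst, Prod.smul_snd, smul_eq_mul]; module)
  let f : (S × S) ⊗[S] (S × S) →ₗ[S] (S × S) ⊗[S] (S × S) := TensorProduct.lift β
  have hf : ∀ m n : S × S, f (m ⊗ₜ n) = (m.1 * n.1 * g₂) • (e ⊗ₜ e)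
      + (m.1 * n.2) • (a • (e ⊗ₜ o) + b • (o ⊗ₜ e))
      + (m.2 * n.1) • (c • (e ⊗ₜ o) + d • (o ⊗ₜ e)) + (m.2 * n.2 * g₀) • (o ⊗ₜ o) :=
    fun m n => rfl
  have hee : f (e ⊗ₜ e) = g₂ • (e ⊗ₜ e) := by simp [hf, hee']
  have heo : f (e ⊗ₜ o) = a • (e ⊗ₜ o) + b • (o ⊗ₜ e) := by simp [hf, hee', hoo']
  have hoe : f (o ⊗ₜ e) = c • (e ⊗ₜ o) + d • (o ⊗ₜ e) := by simp [hf, hee', hoo']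
  have hoo : f (o ⊗ₜ o) = g₀ • (o ⊗ₜ o) := by simp [hf, hoo']
  have gr_cases : ∀ (x y : S) (i : ℤ) (m : S × S), m ∈ (koszul x y).gr i →
      (i = -1 ∧ ∃ r : S, m = r • e) ∨ (i = 0 ∧ ∃ r : S, m = r • o) ∨ m = 0 := by
    rintro x y i ⟨m, n⟩ ⟨hm, hn⟩
    by_cases hi : i = -1
    · subst hi
      have : n = 0 := by simpa using hn
      exact Or.inl ⟨rfl, m, by simp [hee', this]⟩
    · have h0 : m = 0 := by simpa [hi] using hm
      by_cases hi' : i = 0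
      · exact Or.inr (Or.inl ⟨hi', n, by simp [hoo', h0]⟩)
      · have h0' : n = 0 := by simpa [hi'] using hn
        exact Or.inr (Or.inr (by rw [h0, h0']; rfl))
  have he : ∀ x y : S, e ∈ (koszul x y).gr (-1) := fun x y => ⟨by simp, by simp [hee']⟩
  have ho : ∀ x y : S, o ∈ (koszul x y).gr 0 := fun x y => ⟨by simp [hoo'], by simp⟩
  have hse : ∀ x y : S, (koszul x y).sgn e = -e := fun x y => by
    have := signOp_apply (koszul x y).internal (fun i => i) (he x y)
    simpa [sgnElt, MatFac.sgn] using this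
  have hso : ∀ x y : S, (koszul x y).sgn o = o := fun x y => by
    have := signOp_apply (koszul x y).internal (fun i => i) (ho x y)
    simpa [sgnElt, MatFac.sgn] using this
  have hde : ∀ x y : S, (koszul x y).d e = x • o := fun x y => by
    simp [MatFac.d, hee', hoo']
  have hdo : ∀ x y : S, (koszul x y).d o = y • e := fun x y => by
    simp [MatFac.d, hee', hoo']
  have hD : ∀ (x₁ x₂ y₁ y₂ : S) (m n : S × S), (koszul₂ x₁ x₂ y₁ y₂).d (m ⊗ₜ[S] n) =
      (koszul x₁ y₁).d m ⊗ₜ[S] n + (koszul x₁ y₁).sgn m ⊗ₜ[S] (koszul x₂ y₂).d n := by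
    intro x₁ x₂ y₁ y₂ m n
    rw [MatFac.tensor_d]
    exact tensorD_tmul _ _ _ _ _
  have hcomm : f ∘ₗ (koszul₂ x₁ x₂ y₁ y₂).d = (koszul₂ x₁' x₂' y₁' y₂').d ∘ₗ f := by
    have ext : ∀ g g' : (S × S) ⊗[S] (S × S) →ₗ[S] (S × S) ⊗[S] (S × S),
        g (e ⊗ₜ e) = g' (e ⊗ₜ e) → g (e ⊗ₜ o) = g' (e ⊗ₜ o) → g (o ⊗ₜ e) = g' (o ⊗ₜ e) →
        g (o ⊗ₜ o) = g' (o ⊗ₜ o) → g = g' := by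
      intro g g' k1 k2 k3 k4
      refine TensorProduct.ext' fun m n => ?_
      have hm : m = m.1 • e + m.2 • o := by simp [hee', hoo']
      have hn : n = n.1 • e + n.2 • o := by simp [hee', hoo']
      rw [hm, hn]
      simp only [TensorProduct.add_tmul, TensorProduct.tmul_add, TensorProduct.tmul_smul,
        ← TensorProduct.smul_tmul', map_add, map_smul, k1, k2, k3, k4]
    refine ext _ _ ?_ ?_ ?_ ?_
    all_goals
      simp only [LinearMap.comp_apply, hee, heo, hoe, hoo, map_add, map_smul, hD, hde, hdo, hse,
        hso, TensorProduct.tmul_smul, ← TensorProduct.smul_tmul', TensorProduct.neg_tmul, map_neg]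
    · match_scalars
      · linear_combination -h5
      · linear_combination h6
    · match_scalars
      · linear_combination h1
      · linear_combination h7
    · match_scalars
      · linear_combination -h8
      · linear_combination h2
    · match_scalars
      · linear_combination h3
      · linear_combination h4
  let F : MatFac.Hom (koszul₂ x₁ x₂ y₁ y₂) (koszul₂ x₁' x₂' y₁' y₂') :=
    { toLin := f
      map_low := by
        intro g
        refine tensorGr_le (P := ((koszul₂ x₁' x₂' y₁' y₂').low g).comap f) fun i j hij m hm n hn => ?_
        refine (koszul₂ x₁' x₂' y₁' y₂').gr_le_low g ?_
        have hmem : ∀ i j, i + j = g → ∀ m ∈ (koszul x₁' y₁').gr i, ∀ n ∈ (koszul x₂' y₂').gr j,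
            m ⊗ₜ[S] n ∈ (koszul₂ x₁' x₂' y₁' y₂').gr g :=
          fun i j hij m hm n hn => tmul_mem_tensorGr hij hm hn
        rcases gr_cases _ _ _ _ hm with ⟨hi, r, rfl⟩ | ⟨hi, r, rfl⟩ | rfl <;>
          rcases gr_cases _ _ _ _ hn with ⟨hj, s, rfl⟩ | ⟨hj, s, rfl⟩ | rfl <;>
          simp only [TensorProduct.tmul_smul, ← TensorProduct.smul_tmul', map_smul, hee, heo, hoe,
            hoo, TensorProduct.tmul_zero, TensorProduct.zero_tmul, map_zero, smul_zero, zero_mem]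
        · exact Submodule.smul_mem _ _ (Submodule.smul_mem _ _ (Submodule.smul_mem _ _
            (hmem _ _ (by omega) _ (he _ _) _ (he _ _))))
        · exact Submodule.smul_mem _ _ (Submodule.smul_mem _ _ (add_mem
            (Submodule.smul_mem _ _ (hmem _ _ (by omega) _ (he _ _) _ (ho _ _)))
            (Submodule.smul_mem _ _ (hmem _ _ (by omega) _ (ho _ _) _ (he _ _)))))
        · exact Submodule.smul_mem _ _ (Submodule.smul_mem _ _ (add_mem
            (Submodule.smul_mem _ _ (hmem _ _ (by omega) _ (he _ _) _ (ho _ _)))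
            (Submodule.smul_mem _ _ (hmem _ _ (by omega) _ (ho _ _) _ (he _ _)))))
        · exact Submodule.smul_mem _ _ (Submodule.smul_mem _ _ (Submodule.smul_mem _ _
            (hmem _ _ (by omega) _ (ho _ _) _ (ho _ _))))
      comm := hcomm }
  refine ⟨F, ?_⟩
  have h := LinearMap.congr_fun (MatFac.pi_natural (koszul₂_nonPos x₁ x₂ y₁ y₂)
    (koszul₂_nonPos x₁' x₂' y₁' y₂') F) (o ⊗ₜ[S] o)
  have h' : MatFac.piLin _ (koszul₂_nonPos x₁' x₂' y₁' y₂') (f (o ⊗ₜ[S] o)) =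
    F.mapH0 (koszulOne x₁ x₂ y₁ y₂) := by
    rw [koszulOne, ← hoo']
    exact h
  rw [← h', hoo, map_smul, koszulOne, hoo']

theorem exists_pot (ti tj tk tl : S) {k : Type v} [CommRing k] [Algebra k S] (p : Polynomial k) :
    ∃ y₁ y₂ : S, (ti + tj - tk - tl) * y₁ + (ti * tj - tk * tl) * y₂ =
      Polynomial.aeval ti p + Polynomial.aeval tj p - Polynomial.aeval tk p
        - Polynomial.aeval tl p := by
  have key : ∀ n : ℕ, ∃ y₁ y₂ : S, (ti + tj - tk - tl) * y₁ + (ti * tj - tk * tl) * y₂ =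
      ti ^ n + tj ^ n - tk ^ n - tl ^ n := by
    intro n
    induction n using Nat.twoStepInduction with
    | zero => exact ⟨0, 0, by ring⟩
    | one => exact ⟨1, 0, by ring⟩
    | more n h0 h1 =>
      obtain ⟨y₁, y₂, hy⟩ := h0
      obtain ⟨z₁, z₂, hz⟩ := h1
      refine ⟨(ti + tj) * z₁ + (tk ^ (n + 1) + tl ^ (n + 1)) - ti * tj * y₁,
        (ti + tj) * z₂ - (tk ^ n + tl ^ n) - ti * tj * y₂, ?_⟩
      linear_combination (ti + tj) * hz - ti * tj * hy
  induction p using Polynomial.induction_on' with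
  | add p q hp hq =>
    obtain ⟨y₁, y₂, hy⟩ := hp
    obtain ⟨z₁, z₂, hz⟩ := hq
    refine ⟨y₁ + z₁, y₂ + z₂, ?_⟩
    simp only [map_add]
    linear_combination hy + hz
  | monomial n r =>
    obtain ⟨y₁, y₂, hy⟩ := key n
    refine ⟨algebraMap k S r * y₁, algebraMap k S r * y₂, ?_⟩
    simp only [Polynomial.aeval_monomial]
    linear_combination algebraMap k S r * hy

/-- The data of the complex of a crossing exist. -/
theorem nonempty_crossingData (positive : Bool) (ti tj tk tl : S) {k : Type v} [CommRing k]
    [Algebra k S] (p : Polynomial k) :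
    Nonempty (CrossingData positive ti tj tk tl (Polynomial.aeval ti p + Polynomial.aeval tj p
      - Polynomial.aeval tk p - Polynomial.aeval tl p)) := by
  obtain ⟨y₁, y₂, hy⟩ := exists_pot ti tj tk tl p
  let c : CrossingMF ti tj tk tl (Polynomial.aeval ti p + Polynomial.aeval tj p
      - Polynomial.aeval tk p - Polynomial.aeval tl p) :=
    ⟨y₁, y₂, y₁ + tk * y₂, y₁ + ti * y₂, hy, by rw [← hy]; ring⟩
  cases positive with
  | true =>
    obtain ⟨f, hf⟩ := exists_koszulHom (x₁ := ti + tj - tk - tl) (x₂ := ti * tj - tk * tl)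
      (y₁ := y₁) (y₂ := y₂) (x₁' := ti - tl) (x₂' := tj - tk) (y₁' := y₁ + tk * y₂)
      (y₂' := y₁ + ti * y₂) 1 (ti - tk) 1 1 tk ti
      (by ring) (by ring) (by ring) (by ring) (by ring) (by ring) (by ring) (by ring)
    exact ⟨(⟨c, f, by rw [one_smul] at hf; exact hf⟩ : PositiveCrossing _ _ _ _ _)⟩
  | false =>
    obtain ⟨f, hf⟩ := exists_koszulHom (x₁ := ti - tl) (x₂ := tj - tk) (y₁ := y₁ + tk * y₂)
      (y₂ := y₁ + ti * y₂) (x₁' := ti + tj - tk - tl) (x₂' := ti * tj - tk * tl)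
      (y₁' := y₁) (y₂' := y₂) (ti - tk) 1 ti (-1) (-tk) 1
      (by ring) (by ring) (by ring) (by ring) (by ring) (by ring) (by ring) (by ring)
    exact ⟨(⟨c, f, hf⟩ : NegativeCrossing _ _ _ _ _)⟩

end Koszul

/-! ### Oriented tangle diagrams -/

/-- The combinatorial data of an oriented tangle diagram: finitely many crossings, each with a
sign, two outgoing and two incoming slots, labelled left (`false`) and right (`true`) when
looking along the orientation; finitely many end points, which are the start (`Source`) or the
end (`Sink`) of a strand; and finitely many oriented edges, the segments of the diagram between
crossings and end points. Each edge starts at a source or an outgoing slot and ends at a sink or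
an incoming slot, and each of these is used exactly once. Planarity is not needed, so it is not
required. Circles without crossings have no vertex, so they are not recorded; they are excluded
for acyclic diagrams. -/
structure TangleDiagram where
  numCrossings : ℕ
  numEdges : ℕ
  numSources : ℕ
  numSinks : ℕ
  positive : Fin numCrossings → Bool
  tail : Fin numEdges ≃ Fin numSources ⊕ Fin numCrossings × Bool
  head : Fin numEdges ≃ Fin numSinks ⊕ Fin numCrossings × Bool

namespace TangleDiagram

variable (T : TangleDiagram)

abbrev Crossing : Type := Fin T.numCrossings

abbrev Edge : Type := Fin T.numEdges

/-- Vertices of the graph of `T`: crossings and end points. -/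
inductive Vertex : Type
  | source (s : Fin T.numSources)
  | sink (s : Fin T.numSinks)
  | crossing (x : T.Crossing)

/-- The vertex at which an edge starts. -/
def tailVertex (e : T.Edge) : T.Vertex :=
  Sum.elim Vertex.source (fun x => Vertex.crossing x.1) (T.tail e)

/-- The vertex at which an edge ends. -/
def headVertex (e : T.Edge) : T.Vertex :=
  Sum.elim Vertex.sink (fun x => Vertex.crossing x.1) (T.head e)

/-- The graph of `T` has no oriented cycles. -/
def Acyclic : Prop :=
  ∀ v, ¬ Relation.TransGen (fun a b => ∃ e, T.tailVertex e = a ∧ T.headVertex e = b) v v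

/-- Flags (half edges) of the graph of `T`: an edge with its initial or its final vertex. -/
inductive Flag : Type
  | tail (e : T.Edge)
  | head (e : T.Edge)

/-- `ε = 1` if the edge of the flag is directed into the vertex of the flag, else `ε = -1`. -/
def Flag.ε {T : TangleDiagram} : T.Flag → ℤ
  | .tail _ => -1
  | .head _ => 1

/-- The flag at an outgoing slot of a crossing. -/
def outFlag (x : T.Crossing) (right : Bool) : T.Flag := .tail (T.tail.symm (.inr (x, right)))

/-- The flag at an incoming slot of a crossing. -/
def inFlag (x : T.Crossing) (right : Bool) : T.Flag := .head (T.head.symm (.inr (x, right)))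

/-- End points. -/
abbrev EndPoint : Type := Fin T.numSources ⊕ Fin T.numSinks

/-- The unique flag at an end point. -/
def endFlag : T.EndPoint → T.Flag
  | .inl s => .tail (T.tail.symm (.inl s))
  | .inr s => .head (T.head.symm (.inl s))

variable (k : Type u) [CommRing k]

/-- The polynomial ring in the variables `t_f`, for all flags `f`. -/
abbrev Ring : Type u := MvPolynomial T.Flag k

/-- The subring generated by the variables of the flags at end points. -/
abbrev EndRing : Subalgebra k (T.Ring k) :=
  Algebra.adjoin k (Set.range fun a : T.EndPoint => (MvPolynomial.X (T.endFlag a) : T.Ring k))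

variable {k} (p : Polynomial k)

/-- `p(t_f)` -/
def pt (f : T.Flag) : T.Ring k := Polynomial.aeval (MvPolynomial.X f : T.Ring k) p

/-- The potential `∑ ε p(t)` over all end points, as an element of the end point ring. -/
def endPot : T.EndRing k :=
  ∑ a : T.EndPoint, (T.endFlag a).ε • Polynomial.aeval
    (⟨MvPolynomial.X (T.endFlag a), Algebra.subset_adjoin ⟨a, rfl⟩⟩ : T.EndRing k) p

/-- The quotient `(p(t) - p(s)) / (t - s)` in the ring of `T`. -/
def divDiff (t s : T.Ring k) : T.Ring k :=
  (Polynomial.evalSubFactor (p.map (algebraMap k (T.Ring k))) t s).1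

theorem mul_divDiff (t s : T.Ring k) :
    (t - s) * T.divDiff p t s = Polynomial.aeval t p - Polynomial.aeval s p := by
  rw [← Polynomial.eval_map_algebraMap, ← Polynomial.eval_map_algebraMap, mul_comm]
  exact (Polynomial.evalSubFactor (p.map (algebraMap k (T.Ring k))) t s).2.symm

/-- The Koszul matrix factorization of an edge, of potential `p(t_head) - p(t_tail)`. -/
def edgeMF (e : T.Edge) : MatFac.{u, u} (T.Ring k) :=
  koszul (MvPolynomial.X (.head e) - MvPolynomial.X (.tail e))
    (T.divDiff p (MvPolynomial.X (.head e)) (MvPolynomial.X (.tail e)))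

/-- For each crossing `x` the data of its complex, where `i` and `j` are the left and the right
outgoing flags and `k` and `ℓ` are the right and the left incoming flags, so that the potential is
`p(t_i) + p(t_j) - p(t_k) - p(t_ℓ)`. -/
abbrev Choice : Type u :=
  ∀ x : T.Crossing, CrossingData (T.positive x)
    (MvPolynomial.X (T.outFlag x false) : T.Ring k) (MvPolynomial.X (T.outFlag x true))
    (MvPolynomial.X (T.inFlag x true)) (MvPolynomial.X (T.inFlag x false))
    (T.pt p (T.outFlag x false) + T.pt p (T.outFlag x true)
      - T.pt p (T.inFlag x true) - T.pt p (T.inFlag x false))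

/-- Such data exist. -/
theorem nonempty_choice : Nonempty (T.Choice p) :=
  Classical.nonempty_pi.2 fun x => nonempty_crossingData (T.positive x) _ _ _ _ p

variable {p} (c : T.Choice p)

/-- The tensor product of the `L_e` over all edges `e` and the `L_x` over all crossings `x`. -/
def krBigraded : MFComplex.{u, u} (T.Ring k) :=
  MFComplex.tensor
    (MFComplex.tensorList ((List.finRange T.numEdges).map fun e => MFComplex.single (T.edgeMF p e)))
    (MFComplex.tensorList ((List.finRange T.numCrossings).map fun x => (c x).complex))

theorem krBigraded_nonPos : (T.krBigraded c).NonPos := by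
  refine MFComplex.NonPos.tensor (MFComplex.NonPos.tensorList ?_) (MFComplex.NonPos.tensorList ?_)
  · intro C hC
    obtain ⟨e, -, rfl⟩ := List.mem_map.1 hC
    exact MFComplex.single_nonPos (koszul_nonPos _ _)
  · intro C hC
    obtain ⟨x, -, rfl⟩ := List.mem_map.1 hC
    exact (c x).complex_nonPos

/-- The Khovanov-Rozansky complex of `T`. -/
def KR : MFCochain.{u, u} (T.Ring k) := (T.krBigraded c).cochain

theorem KR_nonPos : (T.KR c).NonPos := (T.krBigraded_nonPos c).cochain

/-- The potential of the Khovanov-Rozansky complex. -/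
theorem KR_pot : algebraMap (T.EndRing k) (T.Ring k) (T.endPot p) = (T.KR c).pot := by
  have h1 : (T.KR c).pot = (∑ e : T.Edge, (T.pt p (.head e) - T.pt p (.tail e))) +
      ∑ x : T.Crossing, (T.pt p (T.outFlag x false) + T.pt p (T.outFlag x true)
        - T.pt p (T.inFlag x true) - T.pt p (T.inFlag x false)) := by
    change MFComplex.pot _ + MFComplex.pot _ = _
    rw [MFComplex.tensorList_pot, MFComplex.tensorList_pot, List.map_map, List.map_map,
      ← Fin.sum_univ_def, ← Fin.sum_univ_def]
    refine congrArg₂ _ (Finset.sum_congr rfl fun e _ => ?_) (Finset.sum_congr rfl fun x _ => ?_)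
    · exact T.mul_divDiff p _ _
    · exact (c x).complex_pot
  have h2 : ∑ e : T.Edge, T.pt p (.tail e) = (∑ s, T.pt p (T.endFlag (.inl s))) +
      ∑ x : T.Crossing, (T.pt p (T.outFlag x true) + T.pt p (T.outFlag x false)) := by
    rw [← Equiv.sum_comp T.tail.symm, Fintype.sum_sum_type, Fintype.sum_prod_type]
    simp only [Fintype.sum_bool]
    rfl
  have h3 : ∑ e : T.Edge, T.pt p (.head e) = (∑ s, T.pt p (T.endFlag (.inr s))) +
      ∑ x : T.Crossing, (T.pt p (T.inFlag x true) + T.pt p (T.inFlag x false)) := by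
    rw [← Equiv.sum_comp T.head.symm, Fintype.sum_sum_type, Fintype.sum_prod_type]
    simp only [Fintype.sum_bool]
    rfl
  have h4 : algebraMap (T.EndRing k) (T.Ring k) (T.endPot p) =
      (∑ s, -T.pt p (T.endFlag (.inl s))) + ∑ s, T.pt p (T.endFlag (.inr s)) := by
    have h5 : ∀ a, algebraMap (T.EndRing k) (T.Ring k) (Polynomial.aeval
        (⟨MvPolynomial.X (T.endFlag a), Algebra.subset_adjoin ⟨a, rfl⟩⟩ : T.EndRing k) p) =
        T.pt p (T.endFlag a) := fun a => by
      rw [← Polynomial.aeval_algebraMap_apply]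
      rfl
    rw [endPot, map_sum, Fintype.sum_sum_type]
    simp only [map_zsmul, h5]
    simp [endFlag, Flag.ε]
  rw [h1, h4, Finset.sum_sub_distrib, h2, h3]
  simp only [Finset.sum_add_distrib, Finset.sum_sub_distrib, Finset.sum_neg_distrib]
  ring

/-- The naive Khovanov-Rozansky complex of `T`. -/
abbrev naive : MFCochain.{u, u} (T.Ring k) := (T.KR c).H (T.KR_nonPos c)

/-- The projection from the Khovanov-Rozansky complex to the naive one. -/
def projection : MFCochain.Hom (T.KR c) (T.naive c) := (T.KR c).pi (T.KR_nonPos c)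

/-- The same projection, for complexes of matrix factorizations over the end point ring. -/
def endProjection : MFCochain.Hom
    ((T.KR c).restrict (algebraMap (T.EndRing k) (T.Ring k)) (T.endPot p) (T.KR_pot c))
    ((T.naive c).restrict (algebraMap (T.EndRing k) (T.Ring k)) (T.endPot p) (T.KR_pot c)) :=
  (T.projection c).restrict _ _ _ _

end TangleDiagram

end KhR

end

noncomputable section

/-! The theorem rests on a statement about one matrix factorization and a statement about regular
sequences.

Suppose that `M` lives in degrees `-n, ..., 0` and that `(M, dp)` is a resolution of its `H⁰`. Let
`D` be flat with opposite potential. The total differential of `M ⊗ D` is `dp ⊗ 1` plus terms that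
do not raise the degree of the factor `M`, and the kernel of `M ⊗ D → H⁰ ⊗ D` is exact for `dp ⊗ 1`
by flatness. A cycle in this kernel can therefore be cancelled from its top degree downwards, in
finitely many steps. So the kernel has no total homology, and since the map is onto, it is an
isomorphism on homology. This is `isNearIso_of_resolution`. Apart from the flatness of `D`, its
hypotheses concern only additive groups and maps, so they hold over the end point ring as soon as
they hold over the full ring.

It remains to see that the terms of the complex of an acyclic diagram, with `dp` alone, are exact in
negative degrees (`Acyclic.krBigraded_signed`). Neither the maps `dm` nor the maps `ρ` matter for
this, which is why every choice is allowed. What is left is a direct sum of Koszul complexes, one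
for each choice of `L'` or `L''` at every crossing. The bookkeeping is done by `DominatedBy`, with
Koszul complexes written as iterated cones.

Each of these Koszul sequences is regular after a reordering along the orientation, and iterated
cones do not depend on the order up to isomorphism. An edge contributes a relation that is monic and
linear in the variable of its head. A crossing contributes two relations that determine its two
outgoing variables: both linear for `L''`, one linear and one in effect quadratic for `L'`.
Acyclicity gives an order in which these variables are absent from all earlier relations, and
polynomials monic in a new variable are nonzerodivisors (`mem_span_of_monic`). The induction is
`Acyclic.exists_resolves`; its step on complexes is `Resolves.cone`. -/

namespace KhR

/-! ### A criterion for near-isomorphisms -/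

namespace MatFac

variable {S : Type u} [CommRing S]

/-- `M` lives in degrees `≥ -n`. -/
def BoundedBelow (M : MatFac.{u, v} S) (n : ℕ) : Prop := ∀ i : ℤ, i < -n → M.gr i = ⊥

theorem pr_pr_same (M : MatFac.{u, v} S) (i : ℤ) (m : M.carrier) :
    M.pr i (M.pr i m) = M.pr i m := proj_same M.internal (proj_mem M.internal i m)

theorem pr_pr_ne (M : MatFac.{u, v} S) {i j : ℤ} (h : i ≠ j) (m : M.carrier) :
    M.pr j (M.pr i m) = 0 := proj_ne M.internal (proj_mem M.internal i m) h

theorem pr_sgn (M : MatFac.{u, v} S) (i : ℤ) : M.pr i ∘ₗ M.sgn = M.sgn ∘ₗ M.pr i := by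
  refine graded_ext M.internal fun j m hm => ?_
  have hs : M.sgn m = sgnElt S j • m := signOp_apply M.internal (fun i => i) hm
  by_cases hj : j = i
  · subst hj
    simp [hs, pr, proj_same M.internal hm]
  · simp [hs, pr, proj_ne M.internal hm hj]

/-- Bounds on both sides allow a fixed finite range of degrees for all elements at once, so the
decomposition is an identity of linear maps and survives tensoring. -/
theorem sum_pr {M : MatFac.{u, v} S} (hM : M.NonPos) {n : ℕ} (hn : M.BoundedBelow n) :
    ∑ i ∈ Finset.Icc (-(n : ℤ)) 0, M.pr i = LinearMap.id := by
  refine graded_ext M.internal fun j m hm => ?_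
  rw [LinearMap.sum_apply, LinearMap.id_apply]
  by_cases hj : j ∈ Finset.Icc (-(n : ℤ)) 0
  · exact (Finset.sum_eq_single_of_mem j hj fun i _ hi => proj_ne M.internal hm hi.symm).trans
      (proj_same M.internal hm)
  · have : M.gr j = ⊥ := by
      rw [Finset.mem_Icc, not_and_or, not_le, not_le] at hj
      exact hj.elim (hn j) (hM j)
    rw [this, Submodule.mem_bot] at hm
    simp [hm]

/-- A morphism `f` from a matrix factorization in bounded nonpositive degrees is a near-isomorphism
if it is surjective, vanishes in negative degrees and `(M, dp) → N` is a resolution. -/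
theorem isNearIso_of_resolution {M : MatFac.{u, v} S} {N : MatFac.{u, w} S} (f : Hom M N)
    (hM : M.NonPos) {n : ℕ} (hn : M.BoundedBelow n) (hf : Function.Surjective f.toLin)
    (hneg : ∀ i < 0, ∀ m ∈ M.gr i, f.toLin m = 0) (hdp : ∀ m, f.toLin (M.dp m) = 0)
    (hex : ∀ i, ∀ m ∈ M.gr i, M.dp m = 0 → f.toLin m = 0 → m ∈ LinearMap.range M.dp) :
    IsNearIso.{u, v, w, x} f := by
  intro D hD hDpot
  have hpot : M.pot + D.pot = 0 := by rw [hDpot, add_neg_cancel]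
  -- Only flatness of `D` is used from here on.
  have hD' : Module.Flat S D.carrier := Module.Flat.of_projective
  have hpr : ∀ i m, M.pr (i + 1) (M.dp m) = M.dp (M.pr i m) := M.pr_dp
  have hfpr : ∀ m, f.toLin (M.pr 0 m) = f.toLin m := by
    intro m
    have : f.toLin ∘ₗ M.pr 0 = f.toLin := by
      refine graded_ext M.internal fun j m hm => ?_
      rw [LinearMap.comp_apply]
      rcases lt_trichotomy j 0 with h | h | h
      · rw [hneg j h m hm, pr, proj_ne M.internal hm h.ne, map_zero]
      · rw [pr, proj_same M.internal (h ▸ hm)]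
      · rw [hM j h, Submodule.mem_bot] at hm
        simp [hm]
    exact LinearMap.congr_fun this m
  -- Pairing `dp` with `f` turns the exactness hypothesis, in all degrees at once, into a single
  -- exact sequence to which flatness applies.
  have hexact : Function.Exact M.dp (M.dp.prod f.toLin) := by
    intro m
    constructor
    · intro h
      have h1 : M.dp m = 0 := congrArg Prod.fst h
      have h2 : f.toLin m = 0 := congrArg Prod.snd h
      have : m = ∑ i ∈ Finset.Icc (-(n : ℤ)) 0, M.pr i m := by
        rw [← LinearMap.sum_apply, sum_pr hM hn, LinearMap.id_apply]
      rw [this]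
      refine Submodule.sum_mem (LinearMap.range M.dp) fun i hi => ?_
      refine hex i _ (proj_mem _ _ _) (by rw [← hpr, h1, map_zero]) ?_
      rcases (Finset.mem_Icc.1 hi).2.lt_or_eq with h | h
      · exact hneg i h _ (proj_mem _ _ _)
      · rw [h, hfpr, h2]
    · rintro ⟨m', rfl⟩
      have h0 : M.dp (M.dp m') = 0 := by
        -- This is the component of degree `j + 2` of `d² = pot`; all other terms have degree `j` or
        -- `j - 2`.
        have : M.dp ∘ₗ M.dp = 0 := by
          refine graded_ext M.internal fun j a ha => ?_
          have h := congrArg (M.pr (j + 1 + 1)) (M.d_d a)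
          have ha2 := M.dp_mem _ _ (M.dp_mem _ _ ha)
          have e1 : M.pr (j + 1 + 1) (M.dp (M.dp a)) = M.dp (M.dp a) := proj_same M.internal ha2
          have e2 : M.pr (j + 1 + 1) (M.dp (M.dm a)) = 0 :=
            proj_ne M.internal (M.dp_mem _ _ (M.dm_mem _ _ ha)) (by omega)
          have e3 : M.pr (j + 1 + 1) (M.dm (M.dp a)) = 0 :=
            proj_ne M.internal (M.dm_mem _ _ (M.dp_mem _ _ ha)) (by omega)
          have e4 : M.pr (j + 1 + 1) (M.dm (M.dm a)) = 0 :=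
            proj_ne M.internal (M.dm_mem _ _ (M.dm_mem _ _ ha)) (by omega)
          have e5 : M.pr (j + 1 + 1) a = 0 := proj_ne M.internal ha (by omega)
          rw [LinearMap.comp_apply, LinearMap.zero_apply]
          simpa only [d, LinearMap.add_apply, map_add, map_smul, e1, e2, e3, e4, e5, add_zero,
            smul_zero] using h
        exact LinearMap.congr_fun this m'
      exact Prod.ext h0 (hdp m')
  -- Only the degree in the factor `M` is recorded, since the degrees of `D` need not be bounded.
  set P : ℤ → M.carrier ⊗[S] D.carrier →ₗ[S] M.carrier ⊗[S] D.carrier :=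
    fun i => (M.pr i).rTensor D.carrier with hP
  set q := f.toLin.rTensor D.carrier with hq
  set e := M.dp.rTensor D.carrier with he
  set δ := (tensor M D).d with hδ
  have hδ' : ∀ z, δ z = e z + M.dm.rTensor D.carrier z + TensorProduct.map M.sgn D.d z := by
    intro z
    have : δ = e + M.dm.rTensor D.carrier + TensorProduct.map M.sgn D.d := by
      rw [hδ, tensor_d]
      refine TensorProduct.ext' fun m a => ?_
      simp [he, d, add_tmul]
    rw [this]
    rfl
  have hker : ∀ z, e z = 0 → q z = 0 → ∃ y, e y = z := by
    intro z h1 h2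
    have h3 := Module.Flat.rTensor_exact D.carrier hexact
    refine (h3 z).1 ?_
    refine (TensorProduct.prodLeft S S M.carrier N.carrier D.carrier).injective ?_
    have : ∀ z, TensorProduct.prodLeft S S M.carrier N.carrier D.carrier
        ((M.dp.prod f.toLin).rTensor D.carrier z) = (e z, q z) := by
      intro z
      induction z with
      | zero => simp only [map_zero, Prod.mk_zero_zero]
      | add a b ha hb => simp only [map_add, ha, hb, Prod.mk_add_mk]
      | tmul m a => simp [he, hq]
    rw [this, h1, h2, map_zero]
    rfl
  have hPe : ∀ i z, P (i + 1) (e z) = e (P i z) := by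
    intro i z
    simp only [hP, he, ← LinearMap.comp_apply, ← LinearMap.rTensor_comp]
    congr 2
    exact LinearMap.ext (hpr i)
  have hPm : ∀ i z, P i (M.dm.rTensor D.carrier z) = M.dm.rTensor D.carrier (P (i + 1) z) := by
    intro i z
    simp only [hP, ← LinearMap.comp_apply, ← LinearMap.rTensor_comp]
    congr 2
    refine LinearMap.ext fun m => ?_
    have := M.pr_dm (i + 1) m
    rwa [add_sub_cancel_right] at this
  have hPs : ∀ i z, P i (TensorProduct.map M.sgn D.d z) = TensorProduct.map M.sgn D.d (P i z) := by
    intro i z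
    simp only [hP, ← LinearMap.comp_apply, LinearMap.rTensor, ← TensorProduct.map_comp,
      M.pr_sgn i, LinearMap.id_comp, LinearMap.comp_id]
  have hPP : ∀ i z, P i (P i z) = P i z := by
    intro i z
    simp only [hP, ← LinearMap.comp_apply, ← LinearMap.rTensor_comp]
    congr 2
    exact LinearMap.ext (M.pr_pr_same i)
  have hPP' : ∀ i j z, i ≠ j → P j (P i z) = 0 := by
    intro i j z hij
    simp only [hP, ← LinearMap.comp_apply, ← LinearMap.rTensor_comp]
    have : M.pr j ∘ₗ M.pr i = 0 := LinearMap.ext (M.pr_pr_ne hij)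
    rw [this]
    simp
  have hqP : ∀ z, q (P 0 z) = q z := by
    intro z
    simp only [hP, hq, ← LinearMap.comp_apply, ← LinearMap.rTensor_comp]
    congr 2
    exact LinearMap.ext hfpr
  have hqP' : ∀ i < 0, ∀ z, q (P i z) = 0 := by
    intro i hi z
    simp only [hP, hq, ← LinearMap.comp_apply, ← LinearMap.rTensor_comp]
    have : f.toLin ∘ₗ M.pr i = 0 := LinearMap.ext fun m => hneg i hi _ (proj_mem _ _ _)
    rw [this]
    simp
  have hsum : ∀ z, ∑ i ∈ Finset.Icc (-(n : ℤ)) 0, P i z = z := by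
    intro z
    have : ∑ i ∈ Finset.Icc (-(n : ℤ)) 0, P i = LinearMap.id := by
      refine TensorProduct.ext' fun m a => ?_
      rw [LinearMap.sum_apply]
      simp only [hP, LinearMap.rTensor_tmul, ← TensorProduct.sum_tmul]
      rw [← LinearMap.sum_apply, sum_pr hM hn]
      rfl
    rw [← LinearMap.sum_apply, this]
    rfl
  have hδδ : ∀ z, δ (δ z) = (M.pot + D.pot) • z := (tensor M D).d_d
  have hqδ : ∀ z, q (δ z) = (tensor N D).d (q z) := (f.rTensor D).comm_apply
  -- cycles which are killed by `q` are boundaries of elements killed by `q`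
  have key : ∀ r : ℕ, r ≤ n + 1 → ∀ z, (∀ i : ℤ, -(n + 1 : ℤ) + r < i → i ≤ 0 → P i z = 0) →
      q z = 0 → δ z = 0 → ∃ y, δ y = z ∧ q y = 0 := by
    intro r
    induction r with
    -- The bound starts at `-(n + 1)`, so that for `r = 0` every component in degrees `-n, ..., 0`
    -- vanishes; for `r = n + 1` the condition is empty.
    | zero =>
      intro _ z hz _ _
      have : z = 0 := by
        rw [← hsum z]
        refine Finset.sum_eq_zero fun i hi => hz i ?_ (Finset.mem_Icc.1 hi).2
        have := (Finset.mem_Icc.1 hi).1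
        push_cast
        omega
      exact ⟨0, by simp [this], map_zero _⟩
    | succ r ih =>
      intro hr z hz hqz hδz
      -- `j` is the highest degree in which `z` may have a nonzero component.
      obtain ⟨j, hj⟩ : ∃ j : ℤ, j = -(n + 1 : ℤ) + (r + 1 : ℕ) := ⟨_, rfl⟩
      have hj0 : j ≤ 0 := by omega
      have hPz : ∀ i, j < i → P i z = 0 := by
        intro i hi
        by_cases hi0 : i ≤ 0
        · exact hz i (by omega) hi0
        · have : M.pr i = 0 := by
            refine LinearMap.ext fun m => ?_
            have h := proj_mem M.internal i m
            rw [hM i (by omega), Submodule.mem_bot] at h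
            exact h
          simp [hP, this]
      -- In degree `j + 1` of `δ z = 0`, the terms from `dm` and from the differential of `D`
      -- involve components of `z` in degrees `j + 2` and `j + 1`, which vanish.
      have h1 : e (P j z) = 0 := by
        have h := congrArg (P (j + 1)) (hδ' z)
        rw [hδz, map_zero, map_add, map_add, hPe, hPm, hPs, hPz (j + 1) (by omega),
          hPz (j + 1 + 1) (by omega), map_zero, map_zero, add_zero, add_zero] at h
        exact h.symm
      have h2 : q (P j z) = 0 := by
        rcases hj0.lt_or_eq with h | h
        · exact hqP' j h z
        · rw [h, hqP, hqz]
      obtain ⟨y, hy⟩ := hker _ h1 h2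
      -- Only the component of degree `j - 1` is kept: then `δ y'` cancels the top component of `z`,
      -- otherwise lives in lower degrees, and `y'` is killed by `q` because `j - 1 < 0`.
      obtain ⟨y', hy'⟩ : ∃ y', y' = P (j - 1) y := ⟨_, rfl⟩
      have hey' : e y' = P j z := by
        rw [hy', ← hPe, sub_add_cancel, hy, hPP]
      have hPy' : ∀ i, i ≠ j - 1 → P i y' = 0 := fun i hi => by rw [hy', hPP' _ _ _ hi.symm]
      have hqy' : q y' = 0 := by rw [hy']; exact hqP' _ (by omega) _
      suffices hw : ∃ w, δ w = z - δ y' ∧ q w = 0 by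
        obtain ⟨w, hw, hqw⟩ := hw
        exact ⟨w + y', by rw [map_add, hw, sub_add_cancel], by rw [map_add, hqw, hqy', add_zero]⟩
      refine ih (by omega) (z - δ y') ?_ ?_ ?_
      · intro i hi hi0
        have h3 : P i (e y') = e (P (i - 1) y') := by rw [← hPe, sub_add_cancel]
        rw [map_sub, hδ', map_add, map_add, hPm, hPs, hPy' i (by omega), hPy' (i + 1) (by omega),
          map_zero, map_zero, add_zero, add_zero]
        by_cases hij : i = j
        · rw [hij, hey', hPP, sub_self]
        · rw [h3, hPy' (i - 1) (by omega), map_zero, hPz i (by omega), sub_zero]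
      · rw [map_sub, hqz, hqδ, hqy', map_zero, sub_zero]
      · have h4 := hδδ y'
        rw [map_sub, hδz, h4, hpot, zero_smul, sub_zero]
  have key' : ∀ z, q z = 0 → δ z = 0 → ∃ y, δ y = z ∧ q y = 0 := fun z h1 h2 =>
    key (n + 1) le_rfl z (fun i hi hi0 => by push_cast at hi; omega) h1 h2
  have hqs : Function.Surjective q := LinearMap.rTensor_surjective D.carrier hf
  -- The usual consequence of a surjection with acyclic kernel. For injectivity a bounding element
  -- is lifted along `q`; for surjectivity a lift of a cycle is corrected by an element of the
  -- kernel.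
  constructor
  · rw [injective_iff_map_eq_zero]
    intro z hz
    obtain ⟨⟨z, hzk⟩, rfl⟩ := Submodule.Quotient.mk_surjective _ z
    rw [Hom.mapHt, Submodule.mapQ_apply, Submodule.Quotient.mk_eq_zero] at hz
    obtain ⟨y, hy⟩ : ∃ y, (tensor N D).d y = q z := hz
    obtain ⟨y, rfl⟩ := hqs y
    have hzk' : δ z = 0 := hzk
    obtain ⟨w, hw, -⟩ := key' (z - δ y) (by rw [map_sub, hqδ, hy, sub_self])
      (by rw [map_sub, hzk', hδδ, hpot, zero_smul, sub_zero])
    rw [Submodule.Quotient.mk_eq_zero]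
    exact ⟨w + y, show δ (w + y) = z by rw [map_add, hw]; abel⟩
  · intro z
    obtain ⟨⟨z, hzk⟩, rfl⟩ := Submodule.Quotient.mk_surjective _ z
    obtain ⟨y, rfl⟩ := hqs z
    have hzk' : (tensor N D).d (q y) = 0 := hzk
    obtain ⟨w, hw, hqw⟩ := key' (δ y) (by rw [hqδ, hzk'])
      (by rw [hδδ, hpot, zero_smul])
    refine ⟨Submodule.Quotient.mk ⟨y - w, ?_⟩, ?_⟩
    · change δ (y - w) = 0
      rw [map_sub, hw, sub_self]
    · rw [Hom.mapHt, Submodule.mapQ_apply]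
      congr 1
      refine Subtype.ext ?_
      change q (y - w) = q y
      rw [map_sub, hqw, sub_zero]

end MatFac

/-! ### Tensor products with Koszul complexes as iterated cones -/

/-- A module with an endomorphism `d` (a differential), an endomorphism `s` (the sign of the
degree), and a submodule `neg` (the part of negative degree). -/
structure SignedModule (S : Type u) [CommRing S] where
  carrier : Type u
  [grp : AddCommGroup carrier]
  [mod : Module S carrier]
  d : carrier →ₗ[S] carrier
  s : carrier →ₗ[S] carrier
  neg : Submodule S carrier

attribute [instance] SignedModule.grp SignedModule.mod

namespace SignedModule

variable {S : Type u} [CommRing S]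

/-- All cycles of negative degree are boundaries. -/
def Acyclic (C : SignedModule S) : Prop := ∀ z ∈ C.neg, C.d z = 0 → z ∈ LinearMap.range C.d

/-- An isomorphism of modules which commutes with `d` and `s` and maps `neg` into `neg`. -/
structure Comparison (C C' : SignedModule S) where
  e : C.carrier ≃ₗ[S] C'.carrier
  map_d : ∀ z, e (C.d z) = C'.d (e z)
  map_s : ∀ z, e (C.s z) = C'.s (e z)
  map_neg : ∀ z ∈ C.neg, e z ∈ C'.neg

/-- Acyclicity is pulled back, so one inclusion between the negative parts is enough. -/
theorem Comparison.acyclic {C C' : SignedModule S} (φ : Comparison C C') (h : C'.Acyclic) :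
    C.Acyclic := by
  intro z hz hdz
  obtain ⟨y, hy⟩ := h (φ.e z) (φ.map_neg z hz) (by rw [← φ.map_d, hdz, map_zero])
  refine ⟨φ.e.symm y, φ.e.injective ?_⟩
  rw [φ.map_d, LinearEquiv.apply_symm_apply, hy]

def Comparison.refl (C : SignedModule S) : Comparison C C :=
  ⟨LinearEquiv.refl S _, fun _ => rfl, fun _ => rfl, fun _ h => h⟩

def Comparison.trans {C C' C'' : SignedModule S} (φ : Comparison C C') (ψ : Comparison C' C'') :
    Comparison C C'' where
  e := φ.e.trans ψ.e
  map_d z := by simp [φ.map_d, ψ.map_d]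
  map_s z := by simp [φ.map_s, ψ.map_s]
  map_neg z hz := ψ.map_neg _ (φ.map_neg z hz)

/-- The tensor product. -/
abbrev tensor (C C' : SignedModule S) : SignedModule S where
  carrier := C.carrier ⊗[S] C'.carrier
  d := tensorD C.s C.d C'.d
  s := TensorProduct.map C.s C'.s
  neg := Submodule.map₂ (TensorProduct.mk S C.carrier C'.carrier) C.neg ⊤ ⊔
    Submodule.map₂ (TensorProduct.mk S C.carrier C'.carrier) ⊤ C'.neg

theorem tmul_mem_neg_left {C C' : SignedModule S} {m : C.carrier} (hm : m ∈ C.neg)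
    (n : C'.carrier) : m ⊗ₜ[S] n ∈ (tensor C C').neg :=
  Submodule.mem_sup_left (Submodule.apply_mem_map₂ _ hm trivial)

theorem tmul_mem_neg_right {C C' : SignedModule S} (m : C.carrier) {n : C'.carrier}
    (hn : n ∈ C'.neg) : m ⊗ₜ[S] n ∈ (tensor C C').neg :=
  Submodule.mem_sup_right (Submodule.apply_mem_map₂ _ trivial hn)

theorem tensor_neg_le {C C' : SignedModule S} {P : Submodule S (C.carrier ⊗[S] C'.carrier)}
    (h1 : ∀ m ∈ C.neg, ∀ n, m ⊗ₜ[S] n ∈ P) (h2 : ∀ m, ∀ n ∈ C'.neg, m ⊗ₜ[S] n ∈ P) :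
    (tensor C C').neg ≤ P :=
  sup_le (Submodule.map₂_le.2 fun m hm n _ => h1 m hm n)
    (Submodule.map₂_le.2 fun m _ n hn => h2 m n hn)

/-- A linear isomorphism which is compatible with the structures on pure tensors. -/
def Comparison.ofTensor {C D E : SignedModule S} (e : C.carrier ⊗[S] D.carrier ≃ₗ[S] E.carrier)
    (hd : ∀ m n, e (C.d m ⊗ₜ n + C.s m ⊗ₜ D.d n) = E.d (e (m ⊗ₜ n)))
    (hs : ∀ m n, e (C.s m ⊗ₜ D.s n) = E.s (e (m ⊗ₜ n)))
    (h1 : ∀ m ∈ C.neg, ∀ n, e (m ⊗ₜ n) ∈ E.neg) (h2 : ∀ m, ∀ n ∈ D.neg, e (m ⊗ₜ n) ∈ E.neg) :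
    Comparison (C.tensor D) E where
  e := e
  map_d := LinearMap.congr_fun (f := e.toLinearMap ∘ₗ (C.tensor D).d) (g := E.d ∘ₗ e.toLinearMap)
    (TensorProduct.ext' fun m n => by
      rw [LinearMap.comp_apply, tensorD_tmul]
      exact hd m n)
  map_s := LinearMap.congr_fun (f := e.toLinearMap ∘ₗ (C.tensor D).s) (g := E.s ∘ₗ e.toLinearMap)
    (TensorProduct.ext' hs)
  map_neg := tensor_neg_le (P := E.neg.comap e.toLinearMap) h1 h2

def Comparison.tensor {C C' D D' : SignedModule S} (φ : Comparison C C') (ψ : Comparison D D') :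
    Comparison (C.tensor D) (C'.tensor D') :=
  .ofTensor (TensorProduct.congr φ.e ψ.e)
    (fun m n => by simp [φ.map_d, ψ.map_d, φ.map_s])
    (fun m n => by simp [φ.map_s, ψ.map_s])
    (fun m hm n => tmul_mem_neg_left (φ.map_neg m hm) (ψ.e n))
    (fun m n hn => tmul_mem_neg_right (φ.e m) (ψ.map_neg n hn))

/-- No sign correction is needed: the sign operator of a tensor product is the tensor product of the
sign operators, so in both bracketings the last differential is preceded by both signs. -/
def Comparison.assoc (C D E : SignedModule S) :
    Comparison ((C.tensor D).tensor E) (C.tensor (D.tensor E)) where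
  e := TensorProduct.assoc S _ _ _
  map_d z := by
    refine LinearMap.congr_fun (f := (TensorProduct.assoc S _ _ _).toLinearMap ∘ₗ
      ((C.tensor D).tensor E).d) (g := (C.tensor (D.tensor E)).d ∘ₗ
      (TensorProduct.assoc S _ _ _).toLinearMap) ?_ z
    refine TensorProduct.ext_threefold fun a b c => ?_
    simp [TensorProduct.add_tmul, TensorProduct.tmul_add, add_assoc]
  map_s z := by
    refine LinearMap.congr_fun (f := (TensorProduct.assoc S _ _ _).toLinearMap ∘ₗ
      ((C.tensor D).tensor E).s) (g := (C.tensor (D.tensor E)).s ∘ₗ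
      (TensorProduct.assoc S _ _ _).toLinearMap) ?_ z
    refine TensorProduct.ext_threefold fun a b c => ?_
    simp
  map_neg := by
    refine tensor_neg_le (C := C.tensor D) (C' := E) (P := (C.tensor (D.tensor E)).neg.comap
      (TensorProduct.assoc S C.carrier D.carrier E.carrier).toLinearMap) ?_ ?_
    · intro m hm n
      refine tensor_neg_le (C := C) (C' := D) (P := ((C.tensor (D.tensor E)).neg.comap
        (TensorProduct.assoc S C.carrier D.carrier E.carrier).toLinearMap).comap
          ((TensorProduct.mk S (C.carrier ⊗[S] D.carrier) E.carrier).flip n)) ?_ ?_ hm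
      · intro a ha b
        exact tmul_mem_neg_left (C' := D.tensor E) ha (b ⊗ₜ[S] n)
      · intro a b hb
        exact tmul_mem_neg_right (C' := D.tensor E) a (tmul_mem_neg_left hb n)
    · intro m n hn
      refine TensorProduct.induction_on (motive := fun m => m ⊗ₜ[S] n ∈
        (C.tensor (D.tensor E)).neg.comap
          (TensorProduct.assoc S C.carrier D.carrier E.carrier).toLinearMap) m ?_ ?_ ?_
      · rw [TensorProduct.zero_tmul]
        exact zero_mem _
      · intro a b
        exact tmul_mem_neg_right (C' := D.tensor E) a (tmul_mem_neg_right b hn)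
      · intro a b ha hb
        rw [TensorProduct.add_tmul]
        exact add_mem ha hb

/-- The ground ring in degree `0`. -/
abbrev unit (S : Type u) [CommRing S] : SignedModule S where
  carrier := S
  d := 0
  s := LinearMap.id
  neg := ⊥

def Comparison.tensorUnit (C : SignedModule S) : Comparison C (C.tensor (unit S)) where
  e := (TensorProduct.rid S _).symm
  map_d z := by simp
  map_s z := by simp
  map_neg z hz := tmul_mem_neg_left (C' := unit S) hz (1 : S)

def Comparison.unitTensor (C : SignedModule S) : Comparison ((unit S).tensor C) C :=
  .ofTensor (TensorProduct.lid S C.carrier) (fun m n => by simp) (fun m n => by simp)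
    (fun m hm n => by
      have : m = 0 := hm
      simp [this])
    (fun m n hn => by simpa using C.neg.smul_mem m hn)

/-- The direct sum. -/
abbrev prod (C D : SignedModule S) : SignedModule S where
  carrier := C.carrier × D.carrier
  d := C.d.prodMap D.d
  s := C.s.prodMap D.s
  neg := C.neg.prod D.neg

theorem Acyclic.prod {C D : SignedModule S} (hC : C.Acyclic) (hD : D.Acyclic) :
    (C.prod D).Acyclic := by
  rintro ⟨a, b⟩ ⟨ha, hb⟩ hab
  obtain ⟨a', rfl⟩ := hC a ha (congrArg Prod.fst hab)
  obtain ⟨b', rfl⟩ := hD b hb (congrArg Prod.snd hab)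
  exact ⟨(a', b'), rfl⟩

def Comparison.prodTensor (C D E : SignedModule S) :
    Comparison ((C.prod D).tensor E) ((C.tensor E).prod (D.tensor E)) :=
  .ofTensor (C := C.prod D) (TensorProduct.prodLeft S S _ _ _)
    (fun m n => by
      obtain ⟨a, b⟩ := m
      simp)
    (fun m n => by
      obtain ⟨a, b⟩ := m
      simp)
    (fun m hm n => ⟨tmul_mem_neg_left hm.1 n, tmul_mem_neg_left hm.2 n⟩)
    (fun m n hn => ⟨tmul_mem_neg_right m.1 hn, tmul_mem_neg_right m.2 hn⟩)

/-- The cone of multiplication by `x`. -/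
abbrev cone (x : S) (C : SignedModule S) : SignedModule S where
  carrier := C.carrier × C.carrier
  d := (-(C.d ∘ₗ LinearMap.fst S _ _)).prod
    (x • LinearMap.fst S _ _ + C.d ∘ₗ LinearMap.snd S _ _)
  s := (-C.s).prodMap C.s
  -- The first copy of `C` is shifted down by one, so all of it is negative when `C` has no positive
  -- degrees.
  neg := (⊤ : Submodule S C.carrier).prod C.neg

def Comparison.cone (x : S) {C D : SignedModule S} (φ : Comparison C D) :
    Comparison (C.cone x) (D.cone x) where
  e := LinearEquiv.prodCongr φ.e φ.e
  map_d z := by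
    obtain ⟨a, b⟩ := z
    simp [φ.map_d]
  map_s z := by
    obtain ⟨a, b⟩ := z
    simp [φ.map_s]
  map_neg z hz := ⟨trivial, φ.map_neg _ hz.2⟩

/-- The two copies that are shifted exactly once are interchanged. The copy that is shifted twice
receives a sign, because two generators of odd degree anticommute. -/
def Comparison.coneSwap (x y : S) (C : SignedModule S) :
    Comparison ((C.cone y).cone x) ((C.cone x).cone y) where
  e := (LinearEquiv.prodProdProdComm S C.carrier C.carrier C.carrier C.carrier).trans
    (LinearEquiv.prodCongr (LinearEquiv.prodCongr (LinearEquiv.neg S) (LinearEquiv.refl S _))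
      (LinearEquiv.refl S _))
  map_d z := by
    obtain ⟨⟨a, b⟩, c, d⟩ := z
    refine Prod.ext (Prod.ext ?_ ?_) (Prod.ext ?_ ?_)
    · change -(-(-C.d a)) = -(-C.d (-a))
      rw [_root_.map_neg]
    · change x • a + -C.d c = -(x • -a + C.d c)
      module
    · change -(y • a + C.d b) = y • -a + -C.d b
      module
    · change x • b + (y • c + C.d d) = y • c + (x • b + C.d d)
      module
  map_s z := by
    obtain ⟨⟨a, b⟩, c, d⟩ := z
    simp
  map_neg z hz := ⟨trivial, trivial, hz.2.2⟩

def Comparison.coneProd (x : S) (C D : SignedModule S) :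
    Comparison ((C.prod D).cone x) ((C.cone x).prod (D.cone x)) where
  e := LinearEquiv.prodProdProdComm S C.carrier D.carrier C.carrier D.carrier
  map_d _ := rfl
  map_s _ := rfl
  map_neg _ hz := ⟨⟨trivial, hz.2.1⟩, trivial, hz.2.2⟩

/-- The iterated cone. -/
def cones : List S → SignedModule S → SignedModule S
  | [], C => C
  | x :: l, C => (cones l C).cone x

theorem cones_append (l l' : List S) (C : SignedModule S) :
    cones (l ++ l') C = cones l (cones l' C) := by
  induction l with
  | nil => rfl
  | cons x l ih => rw [List.cons_append, cones, ih, cones]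

def Comparison.cones {C D : SignedModule S} (φ : Comparison C D) :
    ∀ l : List S, Comparison (SignedModule.cones l C) (SignedModule.cones l D)
  | [] => φ
  | x :: l => (φ.cones l).cone x

def Comparison.conesProd (C D : SignedModule S) :
    ∀ l : List S, Comparison (SignedModule.cones l (C.prod D))
      ((SignedModule.cones l C).prod (SignedModule.cones l D))
  | [] => Comparison.refl _
  | x :: l => ((Comparison.conesProd C D l).cone x).trans (Comparison.coneProd x _ _)

/-- Adjacent transpositions generate all permutations. Hence regularity may be proved in an order
adapted to the diagram instead of the order of the tensor factors. -/
theorem nonempty_comparison_of_perm (C : SignedModule S) {l l' : List S} (h : l.Perm l') :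
    Nonempty (Comparison (cones l C) (cones l' C)) := by
  induction h with
  | nil => exact ⟨Comparison.refl _⟩
  | cons x _ ih => exact ih.map fun φ => φ.cone x
  | swap x y l => exact ⟨Comparison.coneSwap y x _⟩
  | trans _ _ ih ih' =>
    obtain ⟨φ⟩ := ih
    obtain ⟨ψ⟩ := ih'
    exact ⟨φ.trans ψ⟩

/-! ### Complexes which are direct sums of Koszul complexes -/

/-- Tensoring with `C` amounts to taking the direct sum of the iterated cones on the sequences in
`L`, as far as acyclicity is concerned. -/
def DominatedBy (C : SignedModule S) (L : Set (List S)) : Prop :=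
  ∀ (ys : List S) (Z : SignedModule S), (∀ xs ∈ L, (cones ys (cones xs Z)).Acyclic) →
    (cones ys (C.tensor Z)).Acyclic

theorem DominatedBy.of_comparison {C D : SignedModule S} {L : Set (List S)} (φ : Comparison C D)
    (h : D.DominatedBy L) : C.DominatedBy L := fun ys Z hZ =>
  ((φ.tensor (Comparison.refl Z)).cones ys).acyclic (h ys Z hZ)

/-- Here the arbitrary prefix `ys` and the arbitrary `Z` are needed: `C` is removed with `D ⊗ Z` in
place of `Z`, and then `D` is removed under the longer prefix `ys ++ xs`. -/
theorem DominatedBy.tensor {C D : SignedModule S} {L L' : Set (List S)} (h : C.DominatedBy L)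
    (h' : D.DominatedBy L') :
    (C.tensor D).DominatedBy {zs | ∃ xs ∈ L, ∃ xs' ∈ L', zs = xs ++ xs'} := fun ys Z hZ => by
  refine ((Comparison.assoc C D Z).cones ys).acyclic (h ys _ fun xs hxs => ?_)
  rw [← cones_append]
  refine h' _ _ fun xs' hxs' => ?_
  rw [← cones_append, List.append_assoc, cones_append]
  exact hZ _ ⟨xs, hxs, xs', hxs', rfl⟩

/-- Tensor products and cones distribute over direct sums. Sets of sequences suffice, since repeated
summands do not affect acyclicity. -/
theorem DominatedBy.prod {C D : SignedModule S} {L L' : Set (List S)} (h : C.DominatedBy L)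
    (h' : D.DominatedBy L') : (C.prod D).DominatedBy (L ∪ L') := fun ys Z hZ =>
  (((Comparison.prodTensor C D Z).cones ys).trans (Comparison.conesProd _ _ ys)).acyclic
    ((h ys Z fun xs hxs => hZ xs (Or.inl hxs)).prod (h' ys Z fun xs hxs => hZ xs (Or.inr hxs)))

theorem dominatedBy_unit : (unit S).DominatedBy {[]} := fun ys Z hZ =>
  ((Comparison.unitTensor Z).cones ys).acyclic (hZ [] rfl)

theorem DominatedBy.acyclic {C : SignedModule S} {L : Set (List S)} (h : C.DominatedBy L)
    (hL : ∀ xs ∈ L, (cones xs (unit S)).Acyclic) : C.Acyclic :=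
  (Comparison.tensorUnit C).acyclic (h [] _ hL)

end SignedModule

/-! ### Matrix factorizations as signed modules -/

open SignedModule

section Signed

variable {S : Type u} [CommRing S]

/-- A matrix factorization with the differential `dp`. -/
abbrev MatFac.signed (M : MatFac.{u, u} S) : SignedModule S where
  carrier := M.carrier
  d := M.dp
  s := M.sgn
  neg := ⨆ (i : ℤ) (_ : i < 0), M.gr i

/-- A complex of matrix factorizations with the differential `dp`. -/
abbrev MFComplex.signed (C : MFComplex.{u, u} S) : SignedModule S where
  carrier := C.carrier
  d := C.dp
  s := C.sgn
  neg := ⨆ (g : ℤ × ℤ) (_ : g.1 < 0), C.gr g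

/-- The degree is additive, so `(-1)^(i + j)` factors. It is used for the degree of a matrix
factorization and for the first of the two degrees of a complex. -/
theorem signOp_tensor {M N : Type*} [AddCommGroup M] [Module S M]
    [AddCommGroup N] [Module S N] {G : Type} [DecidableEq G] [AddCommGroup G]
    {gr : G → Submodule S M} {gr' : G → Submodule S N} (h : DirectSum.IsInternal gr)
    (h' : DirectSum.IsInternal gr') (deg : G →+ ℤ) :
    signOp (isInternal_tensorGr h h') deg = TensorProduct.map (signOp h deg) (signOp h' deg) := by
  refine tensor_graded_ext h h' fun i j m hm n hn => ?_
  rw [signOp_apply _ _ (tmul_mem_tensorGr rfl hm hn), TensorProduct.map_tmul, signOp_apply _ _ hm,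
    signOp_apply _ _ hn, TensorProduct.smul_tmul_smul]
  simp [sgnElt, Int.negOnePow_add]

/-- A negative sum of two degrees has a negative summand. The opposite inclusion of negative parts
can fail when positive degrees occur, and a comparison does not require it. -/
def MatFac.signedTensor (M N : MatFac.{u, u} S) :
    Comparison (M.tensor N).signed (M.signed.tensor N.signed) where
  e := LinearEquiv.refl S _
  map_d _ := rfl
  map_s z := LinearMap.congr_fun (signOp_tensor M.internal N.internal (AddMonoidHom.id ℤ)) z
  map_neg z hz := by
    refine (iSup₂_le fun g hg => tensorGr_le fun i j hij m hm n hn => ?_ :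
      (⨆ (i : ℤ) (_ : i < 0), (M.tensor N).gr i) ≤ (M.signed.tensor N.signed).neg) hz
    by_cases hi : i < 0
    · exact tmul_mem_neg_left (C := M.signed) (C' := N.signed)
        (Submodule.mem_iSup_of_mem i (Submodule.mem_iSup_of_mem hi hm)) n
    · exact tmul_mem_neg_right (C := M.signed) (C' := N.signed) m
        (Submodule.mem_iSup_of_mem j (Submodule.mem_iSup_of_mem (by omega) hn))

def MFComplex.signedTensor (M N : MFComplex.{u, u} S) :
    Comparison (M.tensor N).signed (M.signed.tensor N.signed) where
  e := LinearEquiv.refl S _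
  map_d _ := rfl
  map_s z := LinearMap.congr_fun (signOp_tensor M.internal N.internal (AddMonoidHom.fst ℤ ℤ)) z
  map_neg z hz := by
    refine (iSup₂_le fun g hg => tensorGr_le fun i j hij m hm n hn => ?_ :
      (⨆ (i : ℤ × ℤ) (_ : i.1 < 0), (M.tensor N).gr i) ≤ (M.signed.tensor N.signed).neg) hz
    by_cases hi : i.1 < 0
    · exact tmul_mem_neg_left (C := M.signed) (C' := N.signed)
        (Submodule.mem_iSup_of_mem i (Submodule.mem_iSup_of_mem hi hm)) n
    · have := congrArg Prod.fst hij
      rw [Prod.fst_add] at this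
      exact tmul_mem_neg_right (C := M.signed) (C' := N.signed) m
        (Submodule.mem_iSup_of_mem j (Submodule.mem_iSup_of_mem (by omega) hn))

def MFComplex.signedUnit : Comparison (MFComplex.unit S).signed (SignedModule.unit S) where
  e := LinearEquiv.refl S _
  map_d _ := rfl
  map_s z := by
    have hz : z ∈ (MFComplex.unit S).gr (0, 0) := by simp
    change (MFComplex.unit S).sgn z = z
    rw [MFComplex.sgn, signOp_apply _ _ hz]
    simp [sgnElt]
  map_neg z hz := by
    refine (iSup₂_le fun g hg => ?_ :
      (⨆ (i : ℤ × ℤ) (_ : i.1 < 0), (MFComplex.unit S).gr i) ≤ ⊥) hz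
    have : g ≠ (0, 0) := by
      rintro rfl
      exact lt_irrefl _ hg
    simp [this]

def MFComplex.signedSingle (M : MatFac.{u, u} S) :
    Comparison (MFComplex.single M).signed M.signed where
  e := LinearEquiv.refl S _
  map_d _ := rfl
  map_s z := by
    refine LinearMap.congr_fun (f := (MFComplex.single M).sgn) (g := M.sgn) ?_ z
    refine graded_ext M.internal fun i m hm => ?_
    have h1 : m ∈ (MFComplex.single M).gr (i, 0) := by simpa using hm
    rw [MFComplex.sgn, MatFac.sgn, signOp_apply _ _ hm, signOp_apply _ _ h1]
  map_neg z hz := by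
    refine (iSup₂_le fun g hg => ?_ :
      (⨆ (i : ℤ × ℤ) (_ : i.1 < 0), (MFComplex.single M).gr i) ≤ M.signed.neg) hz
    by_cases h : g.2 = 0
    · simp only [h, if_true]
      exact le_iSup₂_of_le g.1 hg le_rfl
    · simp [h]

/-- The map `f` enters only `dv`, which is forgotten, so a crossing becomes the direct sum of its
two Koszul factorizations. -/
def MFComplex.signedTwoTerm (h₀ : ℤ) {M N : MatFac.{u, u} S} (f : MatFac.Hom M N)
    (hpot : N.pot = M.pot) :
    Comparison (MFComplex.twoTerm h₀ f hpot).signed (M.signed.prod N.signed) where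
  e := LinearEquiv.refl S _
  map_d _ := rfl
  map_s z := by
    refine LinearMap.congr_fun (f := (MFComplex.twoTerm h₀ f hpot).sgn)
      (g := M.sgn.prodMap N.sgn) ?_ z
    refine LinearMap.prod_ext (graded_ext M.internal fun i m hm => ?_)
      (graded_ext N.internal fun i m hm => ?_)
    · have h1 : (m, (0 : N.carrier)) ∈ (MFComplex.twoTerm h₀ f hpot).gr (i, h₀) :=
        ⟨by simpa using hm, zero_mem _⟩
      have h2 : M.sgn m = sgnElt S i • m := signOp_apply M.internal (fun i => i) hm
      have h3 := signOp_apply (MFComplex.twoTerm h₀ f hpot).internal (fun g => g.1) h1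
      simp only [LinearMap.comp_apply, LinearMap.inl_apply, MFComplex.sgn, h3,
        LinearMap.prodMap_apply, map_zero, h2, Prod.smul_mk, smul_zero]
    · have h1 : ((0 : M.carrier), m) ∈ (MFComplex.twoTerm h₀ f hpot).gr (i, h₀ + 1) :=
        ⟨zero_mem _, by simpa using hm⟩
      have h2 : N.sgn m = sgnElt S i • m := signOp_apply N.internal (fun i => i) hm
      have h3 := signOp_apply (MFComplex.twoTerm h₀ f hpot).internal (fun g => g.1) h1
      simp only [LinearMap.comp_apply, LinearMap.inr_apply, MFComplex.sgn, h3,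
        LinearMap.prodMap_apply, map_zero, h2, Prod.smul_mk, smul_zero]
  map_neg z hz := by
    refine (iSup₂_le fun g hg => ?_ :
      (⨆ (i : ℤ × ℤ) (_ : i.1 < 0), (MFComplex.twoTerm h₀ f hpot).gr i) ≤
        (M.signed.prod N.signed).neg) hz
    refine Submodule.prod_mono ?_ ?_
    · by_cases h : g.2 = h₀
      · simp only [h, if_true]
        exact le_iSup₂_of_le g.1 hg le_rfl
      · simp [h]
    · by_cases h : g.2 = h₀ + 1
      · simp only [h, if_true]
        exact le_iSup₂_of_le g.1 hg le_rfl
      · simp [h]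

theorem koszul_sgn (x y : S) (z : S × S) : (koszul x y).sgn z = (-z.1, z.2) := by
  obtain ⟨a, b⟩ := z
  have ha : ((a, 0) : S × S) ∈ (koszul x y).gr (-1) := ⟨by simp, by simp⟩
  have hb : ((0, b) : S × S) ∈ (koszul x y).gr 0 := ⟨by simp, by simp⟩
  have h1 : (koszul x y).sgn (a, 0) = sgnElt S (-1) • (a, 0) :=
    signOp_apply (koszul x y).internal (fun i => i) ha
  have h2 : (koszul x y).sgn (0, b) = sgnElt S 0 • (0, b) :=
    signOp_apply (koszul x y).internal (fun i => i) hb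
  have h3 : ((a, b) : S × S) = (a, 0) + (0, b) := by simp
  rw [h3, map_add, h1, h2]
  simp [sgnElt]

/-- Tensoring with a Koszul factorization is taking a cone. -/
def koszulTensor (x y : S) (Z : SignedModule S) :
    Comparison ((koszul x y).signed.tensor Z) (Z.cone x) :=
  .ofTensor (C := (koszul x y).signed) ((TensorProduct.prodLeft S S S S Z.carrier).trans
      (LinearEquiv.prodCongr (TensorProduct.lid S _) (TensorProduct.lid S _)))
    (fun m n => by
      obtain ⟨a, b⟩ := m
      have h : (koszul x y).signed.s (a, b) = (-a, b) := koszul_sgn x y (a, b)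
      rw [h]
      simp [mul_smul])
    (fun m n => by
      obtain ⟨a, b⟩ := m
      have h : (koszul x y).signed.s (a, b) = (-a, b) := koszul_sgn x y (a, b)
      rw [h]
      simp)
    (fun m hm n => by
      -- The negative part of a Koszul factorization is its summand in degree `-1`.
      have hm' : m.2 = 0 := by
        refine (iSup₂_le fun i hi => ?_ : (⨆ (i : ℤ) (_ : i < 0), (koszul x y).gr i) ≤
          LinearMap.ker (LinearMap.snd S S S)) hm
        rintro ⟨a, b⟩ ⟨-, hb⟩
        simpa [hi.ne] using hb
      refine ⟨trivial, ?_⟩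
      change m.2 • n ∈ Z.neg
      rw [hm', zero_smul]
      exact zero_mem _)
    (fun m n hn => ⟨trivial, Z.neg.smul_mem m.2 hn⟩)

/-- The element `y` occurs only in `dm` and leaves no trace. -/
theorem koszul_dominatedBy (x y : S) : (koszul x y).signed.DominatedBy {[x]} := fun ys Z hZ =>
  ((koszulTensor x y Z).cones ys).acyclic (hZ [x] rfl)

theorem koszul₂_dominatedBy (x₁ x₂ y₁ y₂ : S) :
    (koszul₂ x₁ x₂ y₁ y₂).signed.DominatedBy {[x₁, x₂]} := by
  refine .of_comparison (MatFac.signedTensor _ _) ?_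
  intro ys Z hZ
  refine (koszul_dominatedBy x₁ y₁).tensor (koszul_dominatedBy x₂ y₂) ys Z ?_
  rintro _ ⟨_, rfl, _, rfl, rfl⟩
  exact hZ _ rfl

theorem CrossingData.complex_dominatedBy {ti tj tk tl φ : S} : ∀ {positive : Bool}
    (c : CrossingData positive ti tj tk tl φ), c.complex.signed.DominatedBy
      {[ti + tj - tk - tl, ti * tj - tk * tl], [ti - tl, tj - tk]}
  | true, (c : PositiveCrossing ti tj tk tl φ) =>
    .of_comparison (MFComplex.signedTwoTerm (-1) c.ρ c.toCrossingMF.pot_eq.symm)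
      ((koszul₂_dominatedBy _ _ _ _).prod (koszul₂_dominatedBy _ _ _ _))
  | false, (c : NegativeCrossing ti tj tk tl φ) => by
    -- At a negative crossing `L''` is the first term.
    rw [Set.pair_comm]
    exact .of_comparison (MFComplex.signedTwoTerm 0 c.ρ c.toCrossingMF.pot_eq)
      ((koszul₂_dominatedBy _ _ _ _).prod (koszul₂_dominatedBy _ _ _ _))

/-- A product of sums is expanded: a summand is given by a choice `r` of one sequence for each
factor, and its sequence is the concatenation of the chosen ones. -/
theorem MFComplex.tensorList_dominatedBy {ι : Type*} (F : ι → MFComplex.{u, u} S)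
    (L : ι → Set (List S)) (hF : ∀ i, (F i).signed.DominatedBy (L i)) :
    ∀ l : List ι, l.Nodup → (MFComplex.tensorList (l.map F)).signed.DominatedBy
      {xs | ∃ r : ι → List S, (∀ i ∈ l, r i ∈ L i) ∧ xs = l.flatMap r}
  | [], _ => by
    refine .of_comparison MFComplex.signedUnit fun ys Z hZ => dominatedBy_unit ys Z ?_
    rintro _ rfl
    exact hZ [] ⟨fun _ => [], by simp, rfl⟩
  | j :: l, hl => by
    classical
    refine .of_comparison (MFComplex.signedTensor _ _) fun ys Z hZ =>
      (hF j).tensor (tensorList_dominatedBy F L hF l (List.nodup_cons.1 hl).2) ys Z ?_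
    rintro _ ⟨xs, hxs, _, ⟨r, hr, rfl⟩, rfl⟩
    have hj := (List.nodup_cons.1 hl).1
    have hne : ∀ i ∈ l, i ≠ j := fun i hi hij => hj (hij ▸ hi)
    -- As `j` does not occur in `l`, redefining the choice at `j` leaves the choices along `l`
    -- intact.
    refine hZ _ ⟨Function.update r j xs, fun i hi => ?_, ?_⟩
    · rcases List.mem_cons.1 hi with rfl | hi
      · rwa [Function.update_self]
      · rw [Function.update_of_ne (hne i hi)]
        exact hr i hi
    · rw [List.flatMap_cons, Function.update_self]
      congr 1
      exact List.flatMap_congr fun i hi => (Function.update_of_ne (hne i hi) _ _).symm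

end Signed

/-! ### Regular sequences -/

namespace SignedModule

variable {S : Type u} [CommRing S]

/-- `C` is a resolution of `S ⧸ I`. -/
def Resolves (C : SignedModule S) (I : Ideal S) : Prop :=
  ∃ ε : C.carrier →ₗ[S] S ⧸ I, (∀ z, ε (C.d z) = 0) ∧ (∀ y, ∃ z, C.d z = 0 ∧ ε z = y) ∧
    (∀ z, C.d z = 0 → ε z = 0 → z ∈ LinearMap.range C.d) ∧ ∀ z ∈ C.neg, ε z = 0

/-- The augmentation vanishes on the negative part. The stronger property `Resolves` is the one that
can be carried through cones, where the whole homology must be known. -/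
theorem Resolves.acyclic {C : SignedModule S} {I : Ideal S} (h : C.Resolves I) : C.Acyclic := by
  obtain ⟨ε, -, -, h3, h4⟩ := h
  exact fun z hz hdz => h3 z hdz (h4 z hz)

theorem resolves_unit : (unit S).Resolves ⊥ :=
  ⟨Submodule.mkQ ⊥, fun z => by simp,
    fun y => ⟨_, rfl, (Submodule.mkQ_surjective (⊥ : Ideal S) y).choose_spec⟩, fun z _ hz => by
      have : z = 0 := (Submodule.Quotient.mk_eq_zero (⊥ : Ideal S)).1 hz
      rw [this]
      exact zero_mem _, fun z hz => by
      have : z = 0 := hz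
      simp [this]⟩

/-- The cone of a nonzerodivisor of `S ⧸ I`. -/
theorem Resolves.cone {C : SignedModule S} {G : Set S} (h : C.Resolves (Ideal.span G)) {x : S}
    (hx : ∀ y, x * y ∈ Ideal.span G → y ∈ Ideal.span G) :
    (C.cone x).Resolves (Ideal.span (insert x G)) := by
  obtain ⟨ε, h1, h2, h3, h4⟩ := h
  have hle : Ideal.span G ≤ Ideal.span (insert x G) := Ideal.span_mono (Set.subset_insert x G)
  have hfac : ∀ y, Submodule.factor hle y = 0 → ∃ y', y = x • y' := by
    intro y hy
    obtain ⟨r, rfl⟩ := Submodule.Quotient.mk_surjective _ y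
    have hr : r ∈ Ideal.span (insert x G) := (Submodule.Quotient.mk_eq_zero _).1 hy
    obtain ⟨a, z, hz, rfl⟩ := Ideal.mem_span_insert.1 hr
    refine ⟨Submodule.Quotient.mk a, ?_⟩
    rw [← Submodule.Quotient.mk_smul, Submodule.Quotient.eq, smul_eq_mul, mul_comm x a,
      add_sub_cancel_left]
    exact hz
  have hfac' : ∀ y, Submodule.factor hle (x • y) = 0 := by
    intro y
    obtain ⟨r, rfl⟩ := Submodule.Quotient.mk_surjective _ y
    rw [← Submodule.Quotient.mk_smul]
    refine (Submodule.Quotient.mk_eq_zero _).2 ?_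
    exact Ideal.mul_mem_right _ _ (Ideal.subset_span (Set.mem_insert x G))
  have hinj : ∀ y : S ⧸ Ideal.span G, x • y = 0 → y = 0 := by
    intro y hy
    obtain ⟨r, rfl⟩ := Submodule.Quotient.mk_surjective _ y
    rw [← Submodule.Quotient.mk_smul, Submodule.Quotient.mk_eq_zero] at hy
    exact (Submodule.Quotient.mk_eq_zero _).2 (hx r hy)
  refine ⟨Submodule.factor hle ∘ₗ ε ∘ₗ LinearMap.snd S _ _, ?_, ?_, ?_, ?_⟩
  · rintro ⟨a, b⟩
    change Submodule.factor hle (ε (x • a + C.d b)) = 0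
    rw [map_add, h1, add_zero, map_smul, hfac']
  · intro y
    obtain ⟨y, rfl⟩ := Submodule.factor_surjective hle y
    obtain ⟨z, hz, rfl⟩ := h2 y
    refine ⟨(0, z), Prod.ext ?_ ?_, rfl⟩
    · change -C.d 0 = 0
      rw [map_zero, neg_zero]
    · change x • (0 : C.carrier) + C.d z = 0
      rw [hz, smul_zero, add_zero]
  · rintro ⟨a, b⟩ hd hε
    have ha : C.d a = 0 := neg_eq_zero.1 (congrArg Prod.fst hd)
    have hb : x • a + C.d b = 0 := congrArg Prod.snd hd
    -- Applying `ε` to `x • a + C.d b = 0` gives `x • ε a = 0`, and here `x` is a nonzerodivisor.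
    obtain ⟨a', rfl⟩ : ∃ a', C.d a' = a := by
      refine h3 a ha (hinj _ ?_)
      have := congrArg ε hb
      rwa [map_add, h1, add_zero, map_smul, map_zero] at this
    obtain ⟨y, hy⟩ := hfac (ε b) hε
    -- The cycle `b + x • a'` has augmentation `x • (y + ε a')`. Subtracting `x • c` kills it, and
    -- the remainder is a boundary.
    obtain ⟨c, hc, hcy⟩ := h2 (y + ε a')
    obtain ⟨w, hw⟩ : ∃ w, C.d w = b + x • a' - x • c := by
      refine h3 _ ?_ ?_
      · rw [map_sub, map_add, map_smul, map_smul, hc, smul_zero, sub_zero, add_comm, hb]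
      · rw [map_sub, map_add, map_smul, map_smul, hcy, hy, smul_add]
        abel
    refine ⟨(c - a', w), Prod.ext ?_ ?_⟩
    · change -C.d (c - a') = C.d a'
      rw [map_sub, hc, zero_sub, neg_neg]
    · change x • (c - a') + C.d w = b
      rw [hw]
      module
  · rintro ⟨a, b⟩ ⟨-, hb⟩
    change Submodule.factor hle (ε b) = 0
    rw [h4 b hb, map_zero]

end SignedModule

/-! ### Nonzerodivisors modulo polynomials in which a variable does not occur. -/

section Avoids

variable {σ : Type*} {k : Type*} [CommRing k]

open Classical in
/-- A polynomial, regarded as a polynomial in the variable `t`. -/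
def asPolynomialIn (t : σ) : MvPolynomial σ k →ₐ[k] Polynomial (MvPolynomial σ k) :=
  MvPolynomial.aeval fun s =>
    if s = t then Polynomial.X else Polynomial.C (MvPolynomial.X s)

theorem asPolynomialIn_X_self (t : σ) :
    asPolynomialIn t (MvPolynomial.X t : MvPolynomial σ k) = Polynomial.X := by
  simp [asPolynomialIn]

theorem asPolynomialIn_X_of_ne {s t : σ} (h : s ≠ t) :
    asPolynomialIn t (MvPolynomial.X s : MvPolynomial σ k) = Polynomial.C (MvPolynomial.X s) := by
  simp [asPolynomialIn, h]

/-- Coefficients are taken in the full polynomial ring, so no ring without `t` has to be split off;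
substituting `t` back recovers the polynomial. -/
theorem eval_asPolynomialIn (t : σ) (p : MvPolynomial σ k) :
    (asPolynomialIn t p).eval (MvPolynomial.X t) = p := by
  induction p using MvPolynomial.induction_on with
  | C a =>
    rw [← MvPolynomial.algebraMap_eq, AlgHom.commutes, IsScalarTower.algebraMap_apply k
      (MvPolynomial σ k) (Polynomial (MvPolynomial σ k)), Polynomial.algebraMap_eq,
      Polynomial.eval_C]
  | add p q hp hq => rw [map_add, Polynomial.eval_add, hp, hq]
  | mul_X p s hp =>
    rw [map_mul, Polynomial.eval_mul, hp]
    by_cases h : s = t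
    · rw [h, asPolynomialIn_X_self, Polynomial.eval_X]
    · rw [asPolynomialIn_X_of_ne h, Polynomial.eval_C]

/-- The variable `t` does not occur in `p`. -/
def Avoids (t : σ) (p : MvPolynomial σ k) : Prop := asPolynomialIn t p = Polynomial.C p

theorem avoids_X {s t : σ} (h : s ≠ t) : Avoids t (MvPolynomial.X s : MvPolynomial σ k) :=
  asPolynomialIn_X_of_ne h

theorem Avoids.add {t : σ} {p q : MvPolynomial σ k} (hp : Avoids t p) (hq : Avoids t q) :
    Avoids t (p + q) := by
  rw [Avoids, map_add, hp, hq, Polynomial.C_add]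

theorem Avoids.sub {t : σ} {p q : MvPolynomial σ k} (hp : Avoids t p) (hq : Avoids t q) :
    Avoids t (p - q) := by
  rw [Avoids, map_sub, hp, hq, Polynomial.C_sub]

theorem Avoids.mul {t : σ} {p q : MvPolynomial σ k} (hp : Avoids t p) (hq : Avoids t q) :
    Avoids t (p * q) := by
  rw [Avoids, map_mul, hp, hq, Polynomial.C_mul]

/-- A polynomial which is monic in `t` is a nonzerodivisor modulo polynomials without `t`. -/
theorem mem_span_of_monic {t : σ} {G : Set (MvPolynomial σ k)} (hG : ∀ g ∈ G, Avoids t g)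
    {r : MvPolynomial σ k} (hr : (asPolynomialIn t r).Monic) {y : MvPolynomial σ k}
    (h : r * y ∈ Ideal.span G) : y ∈ Ideal.span G := by
  -- The generators become constants, so the ideal is mapped into its own extension to polynomials.
  have hle : Ideal.span G ≤
      ((Ideal.span G).map Polynomial.C).comap (asPolynomialIn (k := k) t).toRingHom := by
    refine Ideal.span_le.2 fun g hg => ?_
    change asPolynomialIn t g ∈ (Ideal.span G).map Polynomial.C
    rw [hG g hg]
    exact Ideal.mem_map_of_mem _ (Ideal.subset_span hg)
  have hker : ∀ f : Polynomial (MvPolynomial σ k), f ∈ (Ideal.span G).map Polynomial.C ↔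
      f.map (Ideal.Quotient.mk (Ideal.span G)) = 0 := by
    intro f
    rw [Ideal.mem_map_C_iff, Polynomial.ext_iff]
    simp only [Polynomial.coeff_map, Polynomial.coeff_zero, Ideal.Quotient.eq_zero_iff_mem]
  have h1 : asPolynomialIn t (r * y) ∈ (Ideal.span G).map Polynomial.C := hle h
  -- A monic polynomial is a nonzerodivisor over every commutative ring, in particular over the
  -- quotient by the span of `G`.
  rw [map_mul, hker, Polynomial.map_mul, (hr.map _).mul_right_eq_zero_iff, ← hker] at h1
  have h2 : (Ideal.span G).map Polynomial.C ≤
      (Ideal.span G).comap (Polynomial.evalRingHom (MvPolynomial.X t)) := by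
    refine Ideal.map_le_iff_le_comap.2 fun g hg => ?_
    simpa using hg
  have h3 := h2 h1
  rw [Ideal.mem_comap, Polynomial.coe_evalRingHom, eval_asPolynomialIn] at h3
  exact h3

theorem mem_span_of_linear {t : σ} {G : Set (MvPolynomial σ k)} (hG : ∀ g ∈ G, Avoids t g)
    {a : MvPolynomial σ k} (ha : Avoids t a) (y : MvPolynomial σ k)
    (h : (MvPolynomial.X t - a) * y ∈ Ideal.span G) : y ∈ Ideal.span G := by
  refine mem_span_of_monic hG ?_ h
  rw [map_sub, asPolynomialIn_X_self, ha]
  exact Polynomial.monic_X_sub_C a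

theorem mem_span_of_quadratic {t : σ} {G : Set (MvPolynomial σ k)} (hG : ∀ g ∈ G, Avoids t g)
    {a b : MvPolynomial σ k} (ha : Avoids t a) (hb : Avoids t b) (y : MvPolynomial σ k)
    (h : (MvPolynomial.X t ^ 2 + (a * MvPolynomial.X t + b)) * y ∈ Ideal.span G) :
    y ∈ Ideal.span G := by
  refine mem_span_of_monic hG ?_ h
  rw [map_add, map_add, map_mul, map_pow, asPolynomialIn_X_self, ha, hb]
  exact Polynomial.monic_X_pow_add (lt_of_le_of_lt Polynomial.degree_linear_le (by norm_num))

end Avoids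

/-! ### Regularity of the two Koszul sequences of a crossing. -/

section Crossing

variable {σ : Type} {k : Type u} [CommRing k]

-- The relation taken first is linear in the new variable `j` and avoids `i`; the other is linear in
-- the new variable `i`. In an iterated cone the last entry of the list is taken first.
open MvPolynomial in
theorem Resolves.smooth {C : SignedModule (MvPolynomial σ k)} {G : Set (MvPolynomial σ k)}
    (h : C.Resolves (Ideal.span G)) {i j m l : σ} (hij : i ≠ j) (him : m ≠ i) (hil : l ≠ i)
    (hjm : m ≠ j) (hGi : ∀ g ∈ G, Avoids i g) (hGj : ∀ g ∈ G, Avoids j g) :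
    (cones [X i - X l, X j - X m] C).Resolves
      (Ideal.span (insert (X i - X l) (insert (X j - X m) G))) := by
  refine Resolves.cone (Resolves.cone h (mem_span_of_linear hGj (avoids_X hjm))) ?_
  refine mem_span_of_linear (fun g hg => ?_) (avoids_X hil)
  rcases hg with rfl | hg
  · exact (avoids_X hij.symm).sub (avoids_X him)
  · exact hGi g hg

-- The linear relation `f` is monic in `X i`. Modulo `f` the quadratic relation becomes `-q`, where
-- `q = (X j - X m)(X j - X l)` is monic in `X j`. As `f` contains `X j`, the monic criterion does
-- not apply to `q` modulo `f` and `G` directly. Instead, `q` is regular modulo `G` and `f` is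
-- regular modulo `q` and `G`, which by the usual exchange makes `q` regular modulo `f` and `G`.
open MvPolynomial in
theorem Resolves.singular {C : SignedModule (MvPolynomial σ k)} {G : Set (MvPolynomial σ k)}
    (h : C.Resolves (Ideal.span G)) {i j m l : σ} (hij : i ≠ j) (him : m ≠ i) (hil : l ≠ i)
    (hjm : m ≠ j) (hjl : l ≠ j) (hGi : ∀ g ∈ G, Avoids i g) (hGj : ∀ g ∈ G, Avoids j g) :
    (cones [X i * X j - X m * X l, X i + X j - X m - X l] C).Resolves
      (Ideal.span (insert (X i * X j - X m * X l) (insert (X i + X j - X m - X l) G))) := by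
  have e : ∀ p q : MvPolynomial σ k, X i + X j - p - q = X i - (p + q - X j) := fun p q => by ring
  have hlin : ∀ {G' : Set (MvPolynomial σ k)}, (∀ g ∈ G', Avoids i g) → ∀ y : MvPolynomial σ k,
      (X i + X j - X m - X l) * y ∈ Ideal.span G' → y ∈ Ideal.span G' := by
    intro G' hG' y hy
    rw [e] at hy
    exact mem_span_of_linear hG' (((avoids_X him).add (avoids_X hil)).sub (avoids_X hij.symm)) y hy
  refine Resolves.cone (Resolves.cone h (hlin hGi)) fun y hy => ?_
  -- modulo the linear relation the quadratic one is monic in `X j`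
  obtain ⟨f, hf⟩ : ∃ f : MvPolynomial σ k, f = X i + X j - X m - X l := ⟨_, rfl⟩
  obtain ⟨q, hq⟩ : ∃ q : MvPolynomial σ k, q = X j ^ 2 + ((0 - (X m + X l)) * X j + X m * X l) :=
    ⟨_, rfl⟩
  have h0 : ∀ t : σ, Avoids t (0 : MvPolynomial σ k) := fun t => by simp [Avoids]
  have hqy : q * y ∈ Ideal.span (insert f G) := by
    have : q * y = (X j * y) * f - (X i * X j - X m * X l) * y := by rw [hq, hf]; ring
    rw [this]
    exact sub_mem (Ideal.mul_mem_left _ _ (Ideal.subset_span (Set.mem_insert f G))) (hf ▸ hy)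
  obtain ⟨a, z, hz, hqa⟩ := Ideal.mem_span_insert.1 hqy
  -- From `q * y = a * f + z` it follows that `f * a` lies in the ideal of `q` and `G`, and these
  -- avoid the variable `i` in which `f` is monic.
  have ha : a ∈ Ideal.span (insert q G) := by
    refine hlin (fun g hg => ?_) a ?_
    · rcases hg with rfl | hg
      · rw [hq, pow_two]
        exact ((avoids_X hij.symm).mul (avoids_X hij.symm)).add
          ((((h0 i).sub ((avoids_X him).add (avoids_X hil))).mul (avoids_X hij.symm)).add
            ((avoids_X him).mul (avoids_X hil)))
      · exact hGi g hg
    · rw [← hf]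
      have : f * a = y * q - z := by linear_combination -hqa
      rw [this]
      exact sub_mem (Ideal.mul_mem_left _ _ (Ideal.subset_span (Set.mem_insert q G)))
        (Ideal.span_mono (Set.subset_insert q G) hz)
  obtain ⟨b, z', hz', hab⟩ := Ideal.mem_span_insert.1 ha
  -- Inserting `a = b * q + z'` gives a multiple of `q` in the span of `G`, and `G` avoids `j`.
  have hmem : y - b * f ∈ Ideal.span G := by
    refine mem_span_of_quadratic (t := j) (a := 0 - (X m + X l)) (b := X m * X l) hGj
      ((h0 j).sub ((avoids_X hjm).add (avoids_X hjl))) ((avoids_X hjm).mul (avoids_X hjl)) _ ?_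
    rw [← hq]
    have : q * (y - b * f) = f * z' + z := by linear_combination hqa + f * hab
    rw [this]
    exact add_mem (Ideal.mul_mem_left _ _ hz') hz
  rw [← hf]
  exact Ideal.mem_span_insert.2 ⟨b, _, hmem, by ring⟩

end Crossing

/-! ### Acyclic diagrams -/

namespace TangleDiagram

variable (T : TangleDiagram)

instance : Finite T.Vertex := by
  refine Finite.of_surjective (α := Fin T.numSources ⊕ Fin T.numSinks ⊕ T.Crossing)
    (Sum.elim Vertex.source (Sum.elim Vertex.sink Vertex.crossing)) ?_
  rintro (s | s | x)
  · exact ⟨.inl s, rfl⟩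
  · exact ⟨.inr (.inl s), rfl⟩
  · exact ⟨.inr (.inr x), rfl⟩

variable {T}

/-- The rank counts the vertices from which a vertex can be reached. Along an edge this set grows
strictly: the tail precedes the head, but by acyclicity it does not precede itself. -/
theorem Acyclic.exists_rank (hT : T.Acyclic) :
    ∃ ρ : T.Vertex → ℕ, ∀ e, ρ (T.tailVertex e) < ρ (T.headVertex e) := by
  refine ⟨fun v => Set.ncard
    {a | Relation.TransGen (fun a b => ∃ e, T.tailVertex e = a ∧ T.headVertex e = b) a v},
    fun e => Set.ncard_lt_ncard ⟨fun a ha => ?_, fun h => ?_⟩ (Set.toFinite _)⟩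
  · exact Relation.TransGen.tail ha ⟨e, rfl, rfl⟩
  · exact hT _ (h (Relation.TransGen.single ⟨e, rfl, rfl⟩ :
      T.tailVertex e ∈ {a | Relation.TransGen _ a (T.headVertex e)}))

variable {k : Type u} [CommRing k]

variable (T k) in
/-- The sequences of the Koszul factorizations `L'` and `L''` of a crossing. -/
def crossingSequences (x : T.Crossing) : Set (List (T.Ring k)) :=
  {[MvPolynomial.X (T.outFlag x false) + MvPolynomial.X (T.outFlag x true)
      - MvPolynomial.X (T.inFlag x true) - MvPolynomial.X (T.inFlag x false),
    MvPolynomial.X (T.outFlag x false) * MvPolynomial.X (T.outFlag x true)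
      - MvPolynomial.X (T.inFlag x true) * MvPolynomial.X (T.inFlag x false)],
    [MvPolynomial.X (T.outFlag x false) - MvPolynomial.X (T.inFlag x false),
      MvPolynomial.X (T.outFlag x true) - MvPolynomial.X (T.inFlag x true)]}

variable (T k) in
/-- The sequence of the Koszul factorization of an edge. -/
def edgeSequence (e : T.Edge) : List (T.Ring k) :=
  [MvPolynomial.X (.head e) - MvPolynomial.X (.tail e)]

theorem avoids_of_mem_crossingSequences {x : T.Crossing} {xs : List (T.Ring k)}
    (hxs : xs ∈ T.crossingSequences k x) {t : T.Flag} (h1 : ∀ b, T.outFlag x b ≠ t)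
    (h2 : ∀ b, T.inFlag x b ≠ t) {g : T.Ring k} (hg : g ∈ xs) : Avoids t g := by
  have o := fun b => avoids_X (k := k) (h1 b)
  have i := fun b => avoids_X (k := k) (h2 b)
  rcases hxs with rfl | rfl
  · rcases List.mem_pair.1 hg with rfl | rfl
    · exact (((o _).add (o _)).sub (i _)).sub (i _)
    · exact ((o _).mul (o _)).sub ((i _).mul (i _))
  · rcases List.mem_pair.1 hg with rfl | rfl
    · exact (o _).sub (i _)
    · exact (o _).sub (i _)

theorem outFlag_injective {x x' : T.Crossing} {b b' : Bool} (h : T.outFlag x b = T.outFlag x' b') :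
    x = x' ∧ b = b' := by
  simpa [outFlag] using h

/-- The relations of any part of an acyclic diagram form a regular sequence in some order. -/
theorem Acyclic.exists_resolves (hT : T.Acyclic) (r : T.Edge ⊕ T.Crossing → List (T.Ring k))
    (hr : ∀ e, r (.inl e) = T.edgeSequence k e) (hr' : ∀ x, r (.inr x) ∈ T.crossingSequences k x)
    (s : Finset (T.Edge ⊕ T.Crossing)) :
    ∃ (l : List (T.Ring k)) (G : Set (T.Ring k)), l.Perm (s.toList.flatMap r) ∧
      (cones l (SignedModule.unit (T.Ring k))).Resolves (Ideal.span G) ∧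
      ∀ t, (∀ j ∈ s, ∀ g ∈ r j, Avoids t g) → ∀ g ∈ G, Avoids t g := by
  classical
  obtain ⟨ρ, hρ⟩ := hT.exists_rank
  induction s using Finset.induction_on_max_value
    -- Doubling the rank leaves room to place each edge strictly between its tail and its head.
    -- Pieces are added in the order of this key.
    (Sum.elim (fun e => 2 * ρ (T.tailVertex e) + 1) fun x => 2 * ρ (.crossing x)) with
  | empty => exact ⟨[], ∅, by simp, by simpa [cones] using resolves_unit, by simp⟩
  | insert a s ha hmax ih =>
    obtain ⟨l, G, hl, hG, hav⟩ := ih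
    have hperm : ∀ l', l'.Perm (r a) → (l' ++ l).Perm ((insert a s).toList.flatMap r) :=
      fun l' hl' => (hl'.append hl).trans ((Finset.toList_insert ha).flatMap_right r).symm
    have hav' : ∀ t, (∀ j ∈ insert a s, ∀ g ∈ r j, Avoids t g) →
        (∀ g ∈ r a, Avoids t g) ∧ ∀ g ∈ G, Avoids t g := fun t ht =>
      ⟨ht a (Finset.mem_insert_self a s), hav t fun j hj => ht j (Finset.mem_insert_of_mem hj)⟩
    rcases a with e | x
    · have hGe : ∀ g ∈ G, Avoids (.head e) g := by
        refine hav _ fun j hj g hg => ?_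
        rcases j with e' | x
        · rw [hr, edgeSequence, List.mem_singleton] at hg
          rw [hg]
          refine (avoids_X ?_).sub (avoids_X (by simp))
          rintro h
          rw [Flag.head.injEq] at h
          exact ha (h ▸ hj)
        · refine avoids_of_mem_crossingSequences (hr' x) (fun b => by simp [outFlag])
            (fun b hb => ?_) hg
          rw [inFlag, Flag.head.injEq] at hb
          -- The key of this crossing is at least `2 * ρ (T.tailVertex e) + 2`, so it cannot have
          -- been added before `e`.
          have h1 : T.headVertex e = .crossing x := by rw [← hb]; simp [headVertex]
          have h2 := hmax _ hj
          have h3 := hρ e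
          rw [h1] at h3
          simp only [Sum.elim_inl, Sum.elim_inr] at h2
          omega
      refine ⟨r (.inl e) ++ l, insert (MvPolynomial.X (.head e) - MvPolynomial.X (.tail e)) G,
        hperm _ (List.Perm.refl _), ?_, fun t ht g hg => ?_⟩
      · rw [cones_append, hr]
        exact Resolves.cone hG (mem_span_of_linear hGe (avoids_X (by simp)))
      · rcases hg with rfl | hg
        · exact (hav' t ht).1 _ (by rw [hr]; exact List.mem_singleton_self _)
        · exact (hav' t ht).2 g hg
    · have hGx : ∀ b, ∀ g ∈ G, Avoids (T.outFlag x b) g := by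
        intro b
        refine hav _ fun j hj g hg => ?_
        rcases j with e' | x'
        · rw [hr, edgeSequence, List.mem_singleton] at hg
          rw [hg]
          refine (avoids_X (by simp [outFlag])).sub (avoids_X ?_)
          rintro h
          rw [outFlag, Flag.tail.injEq] at h
          have h1 : T.tailVertex e' = .crossing x := by rw [h]; simp [tailVertex]
          have h2 := hmax _ hj
          simp only [Sum.elim_inl, Sum.elim_inr, h1] at h2
          omega
        · refine avoids_of_mem_crossingSequences (hr' x') (fun b' hb => ?_)
            (fun b => by simp [inFlag, outFlag]) hg
          exact ha ((outFlag_injective hb).1 ▸ hj)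
      have hio : ∀ b b', T.inFlag x b ≠ T.outFlag x b' := fun b b' => by simp [inFlag, outFlag]
      have hoo : T.outFlag x false ≠ T.outFlag x true := fun h => by
        simpa using (outFlag_injective h).2
      rcases hr' x with h | h
      · have key := Resolves.singular (σ := T.Flag) (k := k) (G := G) hG hoo (hio true _) (hio false _) (hio _ _) (hio _ _)
            (hGx false) (hGx true)
        rw [← cones_append] at key
        -- The linear relation has to be taken first, that is, to stand last in the list; the given
        -- sequence has it in front.
        refine ⟨_, _, hperm _ (by rw [h]; exact List.Perm.swap _ _ _), key, ?_⟩
        rintro t ht g (rfl | rfl | hg)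
        · exact (hav' t ht).1 _ (by simp [h])
        · exact (hav' t ht).1 _ (by simp [h])
        · exact (hav' t ht).2 g hg
      · have key := Resolves.smooth (σ := T.Flag) (k := k) (G := G) hG hoo (hio true _) (hio false _) (hio _ _)
            (hGx false) (hGx true)
        rw [← cones_append] at key
        have h := Set.mem_singleton_iff.1 h
        refine ⟨_, _, hperm _ (by rw [h]), key, ?_⟩
        rintro t ht g (rfl | rfl | hg)
        · exact (hav' t ht).1 _ (by simp [h])
        · exact (hav' t ht).1 _ (by simp [h])
        · exact (hav' t ht).2 g hg

end TangleDiagram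

/-! ### The Khovanov-Rozansky complex -/

/-! ### Lower bounds for the degrees. -/

section Bounded

variable {S : Type u} [CommRing S]

theorem MatFac.BoundedBelow.tensor {M : MatFac.{u, v} S} {N : MatFac.{u, w} S} {a b : ℕ}
    (hM : M.BoundedBelow a) (hN : N.BoundedBelow b) : (M.tensor N).BoundedBelow (a + b) := by
  intro g hg
  push_cast at hg
  refine le_bot_iff.1 (tensorGr_le fun i j hij m hm n hn => ?_)
  by_cases hi : i < -a
  · rw [hM i hi, Submodule.mem_bot] at hm
    simp [hm]
  · rw [hN j (by omega), Submodule.mem_bot] at hn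
    simp [hn]

theorem koszul_boundedBelow (x y : S) : (koszul x y).BoundedBelow 1 := by
  intro i hi
  have h1 : i ≠ -1 := by
    rintro rfl
    norm_num at hi
  have h2 : i ≠ 0 := by
    rintro rfl
    norm_num at hi
  simp [h1, h2]

/-- `C` lives in degrees `≥ -n`. -/
def MFComplex.BoundedBelow (C : MFComplex.{u, v} S) (n : ℕ) : Prop :=
  ∀ i h : ℤ, i < -n → C.gr (i, h) = ⊥

theorem MFComplex.BoundedBelow.tensor {C : MFComplex.{u, v} S} {D : MFComplex.{u, w} S} {a b : ℕ}
    (hC : C.BoundedBelow a) (hD : D.BoundedBelow b) : (C.tensor D).BoundedBelow (a + b) := by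
  intro g h hg
  push_cast at hg
  refine le_bot_iff.1 (tensorGr_le ?_)
  rintro ⟨i, h⟩ ⟨j, h'⟩ hij m hm n hn
  simp only [Prod.mk_add_mk, Prod.mk.injEq] at hij
  by_cases hi : i < -a
  · rw [hC i h hi, Submodule.mem_bot] at hm
    simp [hm]
  · rw [hD j h' (by omega), Submodule.mem_bot] at hn
    simp [hn]

theorem MFComplex.exists_boundedBelow_tensorList : ∀ l : List (MFComplex.{u, u} S),
    (∀ C ∈ l, ∃ n, C.BoundedBelow n) → ∃ n, (MFComplex.tensorList l).BoundedBelow n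
  | [], _ => ⟨0, fun i h hi => by
      have : i ≠ 0 := by
        rintro rfl
        simp at hi
      change (if (i, h) = (0, 0) then (⊤ : Submodule S S) else ⊥) = ⊥
      simp [this]⟩
  | C :: l, h => by
    obtain ⟨a, ha⟩ := h C (by simp)
    obtain ⟨b, hb⟩ := exists_boundedBelow_tensorList l fun D hD => h D (by simp [hD])
    exact ⟨a + b, ha.tensor hb⟩

theorem MFComplex.single_boundedBelow {M : MatFac.{u, v} S} {n : ℕ} (hM : M.BoundedBelow n) :
    (MFComplex.single M).BoundedBelow n := by
  intro i h hi
  simp [hM i hi]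

theorem MFComplex.twoTerm_boundedBelow {h₀ : ℤ} {M : MatFac.{u, v} S} {N : MatFac.{u, w} S}
    {f : MatFac.Hom M N} {hpot : N.pot = M.pot} {n : ℕ} (hM : M.BoundedBelow n)
    (hN : N.BoundedBelow n) : (MFComplex.twoTerm h₀ f hpot).BoundedBelow n := by
  intro i h hi
  simp [hM i hi, hN i hi]

theorem CrossingData.complex_boundedBelow {ti tj tk tl φ : S} : ∀ {positive : Bool}
    (c : CrossingData positive ti tj tk tl φ), c.complex.BoundedBelow (1 + 1)
  | true, (c : PositiveCrossing ti tj tk tl φ) =>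
    MFComplex.twoTerm_boundedBelow (hpot := c.toCrossingMF.pot_eq.symm)
      ((koszul_boundedBelow _ _).tensor (koszul_boundedBelow _ _))
      ((koszul_boundedBelow _ _).tensor (koszul_boundedBelow _ _))
  | false, (c : NegativeCrossing ti tj tk tl φ) =>
    MFComplex.twoTerm_boundedBelow (hpot := c.toCrossingMF.pot_eq)
      ((koszul_boundedBelow _ _).tensor (koszul_boundedBelow _ _))
      ((koszul_boundedBelow _ _).tensor (koszul_boundedBelow _ _))

end Bounded

/-! ### From exactness of `dp` in negative degrees to near-isomorphisms. -/

section Projection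

variable {S : Type u} [CommRing S]

theorem MFComplex.proj_dp (C : MFComplex.{u, v} S) (i h : ℤ) (m : C.carrier) :
    proj C.internal (i + 1, h) (C.dp m) = C.dp (proj C.internal (i, h) m) := by
  have : proj C.internal (i + 1, h) ∘ₗ C.dp = C.dp ∘ₗ proj C.internal (i, h) := by
    refine graded_ext C.internal fun j m hm => ?_
    obtain ⟨j, a⟩ := j
    by_cases hj : (j, a) = (i, h)
    · rw [Prod.mk.injEq] at hj
      obtain ⟨rfl, rfl⟩ := hj
      simp [proj_same C.internal hm, proj_same C.internal (C.dp_mem _ _ _ hm)]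
    · have hne : (j + 1, a) ≠ (i + 1, h) := by simpa using hj
      simp [proj_ne C.internal hm hj, proj_ne C.internal (C.dp_mem _ _ _ hm) hne]
  exact LinearMap.congr_fun this m

/-- The terms of an acyclic complex are resolutions. -/
theorem MFComplex.term_exact {C : MFComplex.{u, u} S} (hC : C.NonPos) (hac : C.signed.Acyclic)
    (h i : ℤ) (m : C.part h) (hm : m ∈ (C.term h).gr i) (hdp : (C.term h).dp m = 0)
    (hpi : MatFac.piLin (C.term h) (hC.cochain h) m = 0) :
    ∃ w, (C.term h).dp w = m := by
  rcases lt_trichotomy i 0 with hi | rfl | hi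
  · obtain ⟨w, hw⟩ : ∃ w, C.dp w = (m : C.carrier) := hac m
      (Submodule.mem_iSup_of_mem (i, h) (Submodule.mem_iSup_of_mem hi hm)) (congrArg Subtype.val hdp)
    -- The preimage `w` need not be homogeneous; its component of bidegree `(i - 1, h)` already maps
    -- to `m` and lies in the right term.
    refine ⟨⟨proj C.internal (i - 1, h) w,
      Submodule.mem_iSup_of_mem (i - 1) (proj_mem C.internal (i - 1, h) w)⟩, Subtype.ext ?_⟩
    change C.dp (proj C.internal (i - 1, h) w) = m
    rw [← C.proj_dp, hw, sub_add_cancel]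
    exact proj_same C.internal hm
  -- In degree `0` exactness is automatic: being killed by the projection to `H⁰` means being in the
  -- image of `dp`.
  · simp only [MatFac.piLin, LinearMap.comp_apply, Submodule.mkQ_apply,
      Submodule.Quotient.mk_eq_zero] at hpi
    obtain ⟨w, hw⟩ : ∃ w, (C.term h).dp w = (C.term h).pr 0 m := hpi
    exact ⟨w, hw.trans (proj_same (C.term h).internal hm)⟩
  · have h0 : (m : C.carrier) ∈ C.gr (i, h) := hm
    rw [hC i h hi, Submodule.mem_bot] at h0
    exact ⟨0, by rw [map_zero]; exact (Subtype.ext h0).symm⟩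

theorem MFComplex.BoundedBelow.term {C : MFComplex.{u, v} S} {n : ℕ} (hn : C.BoundedBelow n)
    (h : ℤ) : (C.term h).BoundedBelow n := by
  intro i hi
  change (C.gr (i, h)).submoduleOf (C.part h) = ⊥
  rw [hn i h hi, Submodule.submoduleOf, Submodule.comap_bot]
  exact Submodule.ker_subtype _

theorem MatFac.piLin_dp (M : MatFac.{u, v} S) (hM : M.NonPos) (m : M.carrier) :
    piLin M hM (M.dp m) = 0 := piLin_eq_zero hM ⟨M.pr (-1) m, M.dp_pr_neg_one m⟩

theorem MFComplex.isNearIso_pi {C : MFComplex.{u, u} S} (hC : C.NonPos) {n : ℕ}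
    (hn : C.BoundedBelow n) (hac : C.signed.Acyclic) :
    MFCochain.IsNearIso.{u, u, u, x} (C.cochain.pi hC.cochain) := fun h =>
  MatFac.isNearIso_of_resolution (MatFac.pi (C.term h) (hC.cochain h)) (hC.cochain h) (hn.term h)
    (MatFac.piLin_surjective _ (hC.cochain h))
    (fun _ hi _ hm => MatFac.piLin_ne (hC.cochain h) hi.ne hm) (MatFac.piLin_dp _ (hC.cochain h))
    (MFComplex.term_exact hC hac h)

/-- Degrees, surjectivity and exactness do not depend on the scalars, so the criterion applies over
`A` with the same inputs. Nothing is required of `S` as an `A`-module. -/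
theorem MFComplex.isNearIso_pi_restrict {A : Type u'} [CommRing A] {C : MFComplex.{u, u} S}
    (hC : C.NonPos) {n : ℕ} (hn : C.BoundedBelow n) (hac : C.signed.Acyclic) (φ : A →+* S) (a : A)
    (ha : φ a = C.pot) :
    MFCochain.IsNearIso.{u', u, u, x} ((C.cochain.pi hC.cochain).restrict φ a ha ha) := fun h => by
  refine MatFac.isNearIso_of_resolution (n := n)
    ((MatFac.pi (C.term h) (hC.cochain h)).restrict φ a ha ha) ?_ ?_
    (MatFac.piLin_surjective (C.term h) (hC.cochain h))
    (fun _ hi _ hm => MatFac.piLin_ne (hC.cochain h) hi.ne hm)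
    (MatFac.piLin_dp (C.term h) (hC.cochain h)) (MFComplex.term_exact hC hac h)
  · intro i hi
    refine le_bot_iff.1 fun m hm => ?_
    have hm' : m ∈ (C.term h).gr i := hm
    rw [show (C.term h).gr i = ⊥ from hC.cochain h i hi] at hm'
    exact hm'
  · intro i hi
    refine le_bot_iff.1 fun m hm => ?_
    have hm' : m ∈ (C.term h).gr i := hm
    rw [hn.term h i hi] at hm'
    exact hm'

end Projection

/-! ### Exactness for acyclic diagrams. -/

namespace TangleDiagram

variable {T : TangleDiagram} {k : Type u} [CommRing k] {p : Polynomial k}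

theorem exists_krBigraded_boundedBelow (c : T.Choice p) :
    ∃ n, (T.krBigraded c).BoundedBelow n := by
  obtain ⟨a, ha⟩ := MFComplex.exists_boundedBelow_tensorList
    ((List.finRange T.numEdges).map fun e => MFComplex.single (T.edgeMF p e)) fun C hC => by
      obtain ⟨e, -, rfl⟩ := List.mem_map.1 hC
      exact ⟨1, MFComplex.single_boundedBelow (koszul_boundedBelow _ _)⟩
  obtain ⟨b, hb⟩ := MFComplex.exists_boundedBelow_tensorList
    ((List.finRange T.numCrossings).map fun x => (c x).complex) fun C hC => by
      obtain ⟨x, -, rfl⟩ := List.mem_map.1 hC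
      exact ⟨_, (c x).complex_boundedBelow⟩
  exact ⟨a + b, ha.tensor hb⟩

/-- For an acyclic diagram the differentials `dp` of the Khovanov-Rozansky complex are exact in
negative degrees. -/
theorem Acyclic.krBigraded_signed (hT : T.Acyclic) (c : T.Choice p) :
    (T.krBigraded c).signed.Acyclic := by
  have hE := MFComplex.tensorList_dominatedBy (fun e => MFComplex.single (T.edgeMF p e))
    (fun e => {T.edgeSequence k e})
    (fun e => .of_comparison (MFComplex.signedSingle _) (koszul_dominatedBy _ _))
    (List.finRange T.numEdges) (List.nodup_finRange _)
  have hX := MFComplex.tensorList_dominatedBy (fun x => (c x).complex)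
    (fun x => T.crossingSequences k x) (fun x => (c x).complex_dominatedBy)
    (List.finRange T.numCrossings) (List.nodup_finRange _)
  refine (DominatedBy.of_comparison (MFComplex.signedTensor _ _) (hE.tensor hX)).acyclic ?_
  rintro _ ⟨_, ⟨r, hr, rfl⟩, _, ⟨r', hr', rfl⟩, rfl⟩
  -- One summand is fixed by the choices `r` and `r'`; all edges and crossings together give a
  -- regular sequence in the order `l`.
  obtain ⟨l, G, hl, hG, -⟩ := hT.exists_resolves (Sum.elim r r')
    (fun e => hr e (List.mem_finRange e)) (fun x => hr' x (List.mem_finRange x)) Finset.univ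
  -- The tensor product lists all edges before all crossings, whereas `l` interleaves them along the
  -- orientation.
  have hperm : ((List.finRange T.numEdges).flatMap r ++
      (List.finRange T.numCrossings).flatMap r').Perm l := by
    have h1 : (List.finRange T.numEdges).flatMap r ++ (List.finRange T.numCrossings).flatMap r' =
        ((List.finRange T.numEdges).map Sum.inl ++
          (List.finRange T.numCrossings).map Sum.inr).flatMap (Sum.elim r r') := by
      rw [List.flatMap_append, List.flatMap_map, List.flatMap_map]
      rfl
    rw [h1]
    refine (List.Perm.flatMap_right _ ?_).trans hl.symm
    refine (List.perm_ext_iff_of_nodup ?_ (Finset.nodup_toList _)).2 fun j => ?_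
    · refine List.Nodup.append ((List.nodup_finRange _).map Sum.inl_injective)
        ((List.nodup_finRange _).map Sum.inr_injective) ?_
      intro j hj hj'
      obtain ⟨e, -, rfl⟩ := List.mem_map.1 hj
      simp at hj'
    · rcases j with e | x <;> simp
  obtain ⟨ψ⟩ := nonempty_comparison_of_perm (SignedModule.unit (T.Ring k)) hperm
  exact ψ.acyclic hG.acyclic

end TangleDiagram

end KhR

end

theorem theorem2p5 {k : Type u} [CommRing k] (p : Polynomial k) (hp : p.eval 0 = 0)
    (T : KhR.TangleDiagram) (hT : T.Acyclic) (c : T.Choice p) :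
    KhR.MFCochain.IsNearIso.{u, u, u, x} (T.projection c) ∧
      KhR.MFCochain.IsNearIso.{u, u, u, x} (T.endProjection c) := by
  obtain ⟨n, hn⟩ := KhR.TangleDiagram.exists_krBigraded_boundedBelow c
  have hac := hT.krBigraded_signed c
  exact ⟨KhR.MFComplex.isNearIso_pi (T.krBigraded_nonPos c) hn hac,
    KhR.MFComplex.isNearIso_pi_restrict (T.krBigraded_nonPos c) hn hac _ _ _⟩
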